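/- **Conventions.** All graphs are directed graphs on a fixed finite node set $\mathbf V$; $Pa_G(B)$ is the set of parents of $B$ in $G$, and a sink node is a node without children. A route in a DAG $G$ is a finite sequence of (not necessarily distinct) nodes in which consecutive nodes are adjacent. An occurrence of a node $C$ in a route is a collider occurrence if it is the middle of a subroute $A\to C\leftarrow B$ (possibly $A=B$). A route is $\mathbf Z$-active if every collider occurrence is in $\mathbf Z$ and every non-collider occurrence is outside $\mathbf Z$. For disjoint $\mathbf X,\mathbf Y,\mathbf Z\subseteq\mathbf V$, $\mathbf X$ is separated from $\mathbf Y$ given $\mathbf Z$ in $G$ if there is no $\mathbf Z$-active route between a node of $\mathbf X$ and a node of $\mathbf Y$; $I(G)$ is the set of all such separation statements. An arc $A\to B$ of $G$ is covered if $Pa_G(A)=Pa_G(B)\setminus\{A\}$; covering $A\to B$ means adding the smallest set of arcs that makes it covered. A node ordering is consistent with $G$ if $A$ precedes $B$ in it for every arc $A\to B$ of $G$; in a node ordering, earlier nodes are to the left of later ones. **Construct $\beta(G,\alpha)$.** Start with $\beta$ empty and $G'=G$. While $G'$ has nodes: let $A$ be the rightmost node in $\alpha$ that is a sink node in $G'$;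 add $A$ as the leftmost node of $\beta$; as long as $A$ has a right neighbor $B$ in $\beta$ with $A\notin Pa_G(B)$ and $A$ to the right of $B$ in $\alpha$, interchange $A$ and $B$ in $\beta$; then remove $A$ and its incoming arcs from $G'$. Return $\beta$. **Method B2$(G,\alpha)$.** Let $\beta$ be the result of Construct $\beta(G,\alpha)$. While $\beta\neq\alpha$: let $Y$ be the rightmost node in $\alpha$ that has not been considered before; as long as $Y$ has a right neighbor $Z$ in $\beta$ that is to the left of $Y$ in $\alpha$, do the following: if $Y\to Z$ is in $G$, cover it (adding the arcs one at a time) and then reverse it; in either case interchange $Y$ and $Z$ in $\beta$. Return $G$. **Method G2H$(G,H)$.** Choose a node ordering $\alpha$ consistent with $H$; replace $G$ by the result of Method B2$(G,\alpha)$; then add to $G$, one at a time, the arcs that are in $H$ but not in $G$. **Corollary (Method G2H).** Let $G$ and $H$ be DAGs with $I(H)\subseteq I(G)$. Then, whatever consistent ordering $\alpha$ is chosen and in whatever order the arcs are added, Method G2H$(G,H)$ never gets stuck, halts after finitely many steps, and halts with the graph $H$. Every modification of the current graph during the run is the addition of one arc or the reversal of one covered arc, and after every modification the current graph $G$ is a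 DAG with $I(H)\subseteq I(G)$. In particular Meek's conjecture holds: any DAG $G$ with $I(H)\subseteq I(G)$ can be transformed into the DAG $H$ by a finite sequence of arc additions and covered arc reversals such that after each operation $G$ is a DAG and $I(H)\subseteq I(G)$. -/

import Mathlib

namespace BayesNet

variable {V : Type*}

/-! ### Directed graphs, acyclicity, covered arcs

A directed graph on the node set `V` is a `Digraph V`; `G.Adj A B` is the arc `A → B`, and `G ≤ K`
means that every arc of `G` is an arc of `K`. -/

/-- `G` is a directed acyclic graph: no nonempty directed path returns to its start. -/
def IsDAG (G : Digraph V) : Prop :=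
  ∀ v, ¬ Relation.TransGen G.Adj v v

/-- The parents of `B` in `G`. -/
def parents (G : Digraph V) (B : V) : Set V :=
  {A | G.Adj A B}

/-- `A` and `B` are adjacent: there is an arc between them, in one direction or the other. -/
def Adjacent (G : Digraph V) (A B : V) : Prop :=
  G.Adj A B ∨ G.Adj B A

/-- The arc `A → B` is in `G` and is covered. -/
def IsCovered (G : Digraph V) (A B : V) : Prop :=
  G.Adj A B ∧ parents G A = parents G B \ {A}

/-- `G` together with the arc `A → B`. -/
def addArc (G : Digraph V) (A B : V) : Digraph V where
  Adj X Y := G.Adj X Y ∨ (X = A ∧ Y = B)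

/-- `G` with the arc `A → B` replaced by `B → A`. -/
def reverseArc (G : Digraph V) (A B : V) : Digraph V where
  Adj X Y := (G.Adj X Y ∧ ¬ (X = A ∧ Y = B)) ∨ (X = B ∧ Y = A)

/-- `G'` results from `G` by adding one new arc. -/
def IsArcAddition (G G' : Digraph V) : Prop :=
  ∃ A B, ¬ G.Adj A B ∧ G' = addArc G A B

/-- `G'` results from `G` by reversing one covered arc. -/
def IsCoveredArcReversal (G G' : Digraph V) : Prop :=
  ∃ A B, IsCovered G A B ∧ G' = reverseArc G A B

/-- `K` results from `G` by covering `A → B`, that is, by adding the smallest set of arcs that makes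
`A → B` covered. -/
def IsCovering (G : Digraph V) (A B : V) (K : Digraph V) : Prop :=
  IsLeast {K' : Digraph V | G ≤ K' ∧ IsCovered K' A B} K

/-! ### Routes, separation, independence models -/

/-- `ρ` is a route between `A` and `B` in `G`: a sequence of not necessarily distinct nodes, starting
with `A` and ending with `B`, in which consecutive nodes are adjacent. -/
def IsRoute (G : Digraph V) (A B : V) (ρ : List V) : Prop :=
  ρ.head? = some A ∧ ρ.getLast? = some B ∧ ρ.IsChain (Adjacent G)

/-- The occurrence of `C` between the initial part `l₁` and the final part `l₂` of the route
`l₁ ++ C :: l₂` is a collider: it is the middle of a subroute `A → C ← B`. -/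
def IsColliderOcc (G : Digraph V) (l₁ : List V) (C : V) (l₂ : List V) : Prop :=
  ∃ A B, l₁.getLast? = some A ∧ l₂.head? = some B ∧ G.Adj A C ∧ G.Adj B C

/-- The route `ρ` is `S`-active: every collider occurrence of a node in `ρ` is in `S` and every
non-collider occurrence of a node in `ρ` (the two ends included) is outside `S`. -/
def IsActive (G : Digraph V) (S : Set V) (ρ : List V) : Prop :=
  ∀ l₁ C l₂, ρ = l₁ ++ C :: l₂ →
    (IsColliderOcc G l₁ C l₂ → C ∈ S) ∧ (¬ IsColliderOcc G l₁ C l₂ → C ∉ S)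

/-- `X` is separated from `Y` given `S` in `G`: there is no `S`-active route between a node of `X`
and a node of `Y`. -/
def Separated (G : Digraph V) (X Y S : Set V) : Prop :=
  ¬ ∃ A ∈ X, ∃ B ∈ Y, ∃ ρ, IsRoute G A B ρ ∧ IsActive G S ρ

/-- The independence model `I(G)` induced by `G`: all separation statements `X ⊥_G Y | S` with
`X`, `Y`, `S` disjoint sets of nodes. -/
def indepModel (G : Digraph V) : Set (Set V × Set V × Set V) :=
  {t | Disjoint t.1 t.2.1 ∧ Disjoint t.1 t.2.2 ∧ Disjoint t.2.1 t.2.2 ∧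
    Separated G t.1 t.2.1 t.2.2}

/-! ### Node orderings -/

/-- `α` is an ordering of all the nodes, from left to right. -/
def IsNodeOrdering (α : List V) : Prop :=
  α.Nodup ∧ ∀ v, v ∈ α

/-- `A` is to the left of `B` in `α`. -/
def LeftOf [DecidableEq V] (α : List V) (A B : V) : Prop :=
  α.idxOf A < α.idxOf B

/-- `G` and the node ordering `α` are consistent. -/
def Consistent [DecidableEq V] (G : Digraph V) (α : List V) : Prop :=
  ∀ A B, G.Adj A B → LeftOf α A B

/-- `A` is the rightmost node in `α` with the property `P`. -/
def IsRightmost [DecidableEq V] (α : List V) (P : V → Prop) (A : V) : Prop :=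
  P A ∧ ∀ B, P B → B ≠ A → LeftOf α B A

/-! ### Construct β and Method B2

The methods are written as step relations between states, one step per elementary instruction, so
that everything the pseudocode leaves open (the order in which arcs are added, the choice of a
consistent ordering) is open here too. -/

open Classical in
/-- The inner loop of Construct β: put `A` at the left end of `β`, then, as long as `A` has a right
neighbor `B` with `A ∉ Pa_G(B)` and `A` is to the right of `B` in `α`, interchange `A` and `B`. -/
noncomputable def place [DecidableEq V] (G : Digraph V) (α : List V) (A : V) : List V → List V
  | [] => [A]
  | B :: β => if A ∉ parents G B ∧ LeftOf α B A then B :: place G α A β else A :: B :: β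

/-- `A` is a sink node of the subgraph of `G` induced by `R`. -/
def IsSinkIn (G : Digraph V) (R : Finset V) (A : V) : Prop :=
  A ∈ R ∧ ∀ B ∈ R, ¬ G.Adj A B

/-- The states of Method B2. In each of them `G` is the current graph and `β` the current ordering. -/
inductive B2State (V : Type*) where
  /-- Construct β is running; `R` is the set of nodes of the remaining graph `G'`, the subgraph of
  `G` induced by `R`. -/
  | construct (G : Digraph V) (R : Finset V) (β : List V)
  /-- About to test whether `β` differs from `α` and, if so, to select the next node `Y`; `D` is the
  set of nodes considered before. -/
  | select (G : Digraph V) (β : List V) (D : Finset V)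
  /-- Percolating `Y`: about to inspect the right neighbor of `Y` in `β`. -/
  | percolate (G : Digraph V) (β : List V) (D : Finset V) (Y : V)
  /-- Covering and reversing `Y → Z`; `K` is the graph in which the covering will result. -/
  | cover (G K : Digraph V) (β : List V) (D : Finset V) (Y Z : V)
  /-- About to interchange `Y` and its right neighbor `Z` in `β`. -/
  | interchange (G : Digraph V) (β : List V) (D : Finset V) (Y Z : V)
  /-- The method has returned `G`. -/
  | ret (G : Digraph V)

/-- The current graph of a state of Method B2. -/
def B2State.graph : B2State V → Digraph V
  | construct G _ _ => G
  | select G _ _ => G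
  | percolate G _ _ _ => G
  | cover G _ _ _ _ _ => G
  | interchange G _ _ _ _ => G
  | ret G => G

/-- Method B2 with the node ordering `α` starts by calling Construct β, with `β` empty and
`G' = G`. -/
def B2State.init [Fintype V] (G : Digraph V) : B2State V :=
  .construct G Finset.univ []

/-- The steps of Method B2 with the node ordering `α`. The loop over the nodes is written with its
test `β ≠ α` first: when `β = α` from the start, the first pass of a loop that tests last changes
nothing. -/
inductive B2Step [DecidableEq V] (α : List V) : B2State V → B2State V → Prop
  /-- Take the rightmost node `A` in `α` that is a sink node in `G'`, place it in `β`, and remove it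
  and its incoming arcs from `G'`. -/
  | construct_next (G R β A) (hA : IsRightmost α (IsSinkIn G R) A) :
      B2Step α (.construct G R β) (.construct G (R.erase A) (place G α A β))
  /-- `G'` is empty: Construct β returns `β`. -/
  | construct_end (G β) :
      B2Step α (.construct G ∅ β) (.select G β ∅)
  /-- `β ≠ α`: let `Y` be the rightmost node in `α` that has not been considered before. -/
  | select_next (G β D Y) (hβ : β ≠ α) (hY : IsRightmost α (fun v => v ∉ D) Y) :
      B2Step α (.select G β D) (.percolate G β (insert Y D) Y)
  /-- `β = α`: return `G`. -/
  | select_end (G D) :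
      B2Step α (.select G α D) (.ret G)
  /-- The right neighbor `Z` of `Y` in `β` is to the left of `Y` in `α`, and `Y → Z` is in `G`:
  cover and reverse `Y → Z`. -/
  | percolate_arc (G K l₁ l₂ D Y Z) (hZ : LeftOf α Z Y) (hYZ : G.Adj Y Z)
      (hK : IsCovering G Y Z K) :
      B2Step α (.percolate G (l₁ ++ Y :: Z :: l₂) D Y) (.cover G K (l₁ ++ Y :: Z :: l₂) D Y Z)
  /-- The right neighbor `Z` of `Y` in `β` is to the left of `Y` in `α`, and `Y → Z` is not
  in `G`. -/
  | percolate_noarc (G l₁ l₂ D Y Z) (hZ : LeftOf α Z Y) (hYZ : ¬ G.Adj Y Z) :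
      B2Step α (.percolate G (l₁ ++ Y :: Z :: l₂) D Y) (.interchange G (l₁ ++ Y :: Z :: l₂) D Y Z)
  /-- `Y` has no right neighbor in `β` that is to the left of `Y` in `α`. -/
  | percolate_end (G β D Y) (h : ∀ l₁ Z l₂, β = l₁ ++ Y :: Z :: l₂ → ¬ LeftOf α Z Y) :
      B2Step α (.percolate G β D Y) (.select G β D)
  /-- While covering: add any one of the arcs that are still missing. -/
  | cover_add (G K β D Y Z A B) (hK : K.Adj A B) (hG : ¬ G.Adj A B) :
      B2Step α (.cover G K β D Y Z) (.cover (addArc G A B) K β D Y Z)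
  /-- The covering is complete: reverse `Y → Z`. -/
  | cover_reverse (K β D Y Z) :
      B2Step α (.cover K K β D Y Z) (.interchange (reverseArc K Y Z) β D Y Z)
  /-- Interchange `Y` and `Z` in `β`. -/
  | swap (G l₁ l₂ D Y Z) :
      B2Step α (.interchange G (l₁ ++ Y :: Z :: l₂) D Y Z) (.percolate G (l₁ ++ Z :: Y :: l₂) D Y)

/-! ### Method G2H -/

/-- The states of Method G2H. -/
inductive G2HState (V : Type*) where
  /-- About to choose a node ordering consistent with `H`. -/
  | start (G : Digraph V)
  /-- Running Method B2 with the node ordering `α`. -/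
  | runB2 (α : List V) (s : B2State V)
  /-- Adding to `G` the arcs that are in `H` but not in `G`. -/
  | addMissing (G : Digraph V)
  /-- The method has halted with the graph `G`. -/
  | halt (G : Digraph V)

/-- The current graph of a state of Method G2H. -/
def G2HState.graph : G2HState V → Digraph V
  | start G => G
  | runB2 _ s => s.graph
  | addMissing G => G
  | halt G => G

/-- The steps of Method G2H with target `H`. -/
inductive G2HStep [Fintype V] [DecidableEq V] (H : Digraph V) : G2HState V → G2HState V → Prop
  /-- Choose any node ordering `α` that is consistent with `H`, and call Method B2. -/
  | choose (G α) (hα : IsNodeOrdering α) (hH : Consistent H α) :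
      G2HStep H (.start G) (.runB2 α (.init G))
  /-- A step of Method B2. -/
  | b2 (α s s') (h : B2Step α s s') :
      G2HStep H (.runB2 α s) (.runB2 α s')
  /-- Method B2 has returned. -/
  | b2_ret (α G) :
      G2HStep H (.runB2 α (.ret G)) (.addMissing G)
  /-- Add any one of the arcs that are in `H` but not in `G`. -/
  | add (G A B) (hH : H.Adj A B) (hG : ¬ G.Adj A B) :
      G2HStep H (.addMissing G) (.addMissing (addArc G A B))
  /-- No arc of `H` is missing in `G`. -/
  | finish (G) (h : H ≤ G) :
      G2HStep H (.addMissing G) (.halt G)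

/-- `s` occurs in some run of Method G2H on the input `G`, `H`. -/
def G2HReachable [Fintype V] [DecidableEq V] (G H : Digraph V) (s : G2HState V) : Prop :=
  Relation.ReflTransGen (G2HStep H) (.start G) s

end BayesNet

namespace BayesNet

variable {V : Type*}

/-! ### Active walks -/

/-! Let `G₀` be the input graph. An arc A → B that respects an ordering is forced as soon as `G₀`
has an active walk between A and B given the other predecessors of B: a graph consistent with the
ordering but without this arc separates A from B given those predecessors, so its independence model
cannot lie inside that of `G₀`. Method B2 keeps all arcs of its graph forced for the current
ordering (`IsNecessary`). Once the ordering is α, the graph is therefore a subgraph of `H`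
(`IsNecessary.le`), and adding the missing arcs yields `H`.

The inclusion of `indepModel H` in the model of the current graph is not carried along. It is read
off backwards from the final graph `H`: arc additions and covered arc reversals never enlarge the
independence model (`indepModel_anti`, `indepModel_reverseArc`), and every state of a run leads to
`H` by such modifications (`G2HState.Inv.run`).

The heart is that `IsNecessary` survives the exchange of neighbors Y, Z with common predecessors P.
Two facts about `G₀` suffice. First, Z has no descendant in P ∪ {Y}, so conditioning on Z blocks no
walk between these nodes. Second, Y has a directed path to a node of P ∪ {Z} whose interior avoids
P, so a collider at Y can be repaired when Y leaves the conditioning set. The second fact comes from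
the greedy choice of sinks in Construct β (`IsGreedy.exists_descendant`). An arc added by a covering
is justified by splicing two active walks at Y or at Z (`linked_left_of_linked_pair`,
`linked_right_of_linked_pair`). -/

/-- There is a nonempty walk in `G` from `a` to `b` all of whose interior occurrences are
`S`-active. The Boolean next to an end node says whether the walk has an arrowhead there. -/
inductive Conn (G : Digraph V) (S : Set V) : V → Bool → V → Bool → Prop
  | arc {a b} (h : G.Adj a b) : Conn G S a false b true
  | rev {a b} (h : G.Adj a b) : Conn G S b true a false
  | comp {a s v t s' b t'} (h₁ : Conn G S a s v t) (h₂ : Conn G S v s' b t')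
      (hv : v ∈ S ↔ (t = true ∧ s' = true)) : Conn G S a s b t'

/-- There is a possibly trivial walk in `G` from `x` to `v` all of whose occurrences before the last
one are `S`-active. The Boolean says whether the walk has an arrowhead at `v`. -/
inductive Trail (G : Digraph V) (S : Set V) (x : V) : V → Bool → Prop
  | start : Trail G S x x false
  | down {v d w} (h : Trail G S x v d) (hv : v ∉ S) (e : G.Adj v w) : Trail G S x w true
  | up {v d w} (h : Trail G S x v d) (hv : v ∈ S ↔ d = true) (e : G.Adj w v) : Trail G S x w false

theorem Conn.symm {G : Digraph V} {S : Set V} {a s b t} (h : Conn G S a s b t) :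
    Conn G S b t a s := by
  induction h with
  | arc h => exact .rev h
  | rev h => exact .arc h
  | comp _ _ hv ih₁ ih₂ => exact .comp ih₂ ih₁ (hv.trans and_comm)

/-- An arbitrary trail is allowed in front so that the two halves of a composite walk can be
appended one after the other. -/
theorem Conn.trail {G : Digraph V} {S : Set V} {a s b t} (h : Conn G S a s b t) {x d}
    (hx : Trail G S x a d) (ha : a ∈ S ↔ (d = true ∧ s = true)) : Trail G S x b t := by
  induction h generalizing d with
  | arc e => exact .down hx (by simpa using ha) e
  | rev e => exact .up hx (by simpa using ha) e
  | comp _ _ hv ih₁ ih₂ => exact ih₂ (ih₁ hx ha) hv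

/-- A walk that leaves `a` along an arc out of `a` leads from `a` down to a node in `S`, or to its
other end. -/
theorem Conn.descends {G : Digraph V} {S : Set V} {a s b t} (h : Conn G S a s b t) (hs : s = false) :
    ∃ c, Relation.TransGen G.Adj a c ∧ (c ∈ S ∨ (c = b ∧ t = true)) := by
  induction h with
  | arc e => exact ⟨_, .single e, .inr ⟨rfl, rfl⟩⟩
  | rev => cases hs
  | @comp a s v t s' b t' _ _ hv ih₁ ih₂ =>
    obtain ⟨c, hc, hcS | ⟨rfl, rfl⟩⟩ := ih₁ hs
    · exact ⟨c, hc, .inl hcS⟩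
    · cases s'
      · obtain ⟨c', hc', h'⟩ := ih₂ rfl
        exact ⟨c', hc.trans hc', h'⟩
      · exact ⟨c, hc, .inl (hv.2 ⟨rfl, rfl⟩)⟩

/-- A node without descendants among `S` and the ends can be added to the conditioning set. -/
theorem Conn.condition {G : Digraph V} {S : Set V} {a s b t} (h : Conn G S a s b t) {z : V}
    (hS : ∀ c ∈ S, ¬ Relation.TransGen G.Adj z c) (ha : s = true → ¬ Relation.TransGen G.Adj z a)
    (hb : t = true → ¬ Relation.TransGen G.Adj z b) : Conn G (insert z S) a s b t := by
  induction h with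
  | arc e => exact .arc e
  | rev e => exact .rev e
  | @comp a s v t s' b t' h₁ h₂ hv ih₁ ih₂ =>
    -- Below an arrowhead at `v` the walk has a collider, so `v ∈ S`, or it descends from `v` to `S`
    -- or to the end `b`; a path from `z` to `v` would continue to a forbidden descendant.
    have hvt : t = true → ¬ Relation.TransGen G.Adj z v := by
      rintro rfl hzv
      cases s'
      · obtain ⟨c, hc, hcS | ⟨rfl, rfl⟩⟩ := h₂.descends rfl
        · exact hS c hcS (hzv.trans hc)
        · exact hb rfl (hzv.trans hc)
      · exact hS v (hv.2 ⟨rfl, rfl⟩) hzv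
    have hvs : s' = true → ¬ Relation.TransGen G.Adj z v := by
      rintro rfl hzv
      cases t
      · obtain ⟨c, hc, hcS | ⟨rfl, rfl⟩⟩ := h₁.symm.descends rfl
        · exact hS c hcS (hzv.trans hc)
        · exact ha rfl (hzv.trans hc)
      · exact hS v (hv.2 ⟨rfl, rfl⟩) hzv
    refine .comp (ih₁ ha hvt) (ih₂ hvs hb) ?_
    rw [Set.mem_insert_iff, hv, or_iff_right_iff_imp]
    -- If the walk passes through `z` itself, it must have a collider there: leaving `z` along an
    -- outgoing arc would lead down to `S` or to an end.
    rintro rfl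
    constructor
    · by_contra ht
      obtain ⟨c, hc, hcS | ⟨rfl, rfl⟩⟩ := h₁.symm.descends (by simpa using ht)
      · exact hS c hcS hc
      · exact ha rfl hc
    · by_contra ht
      obtain ⟨c, hc, hcS | ⟨rfl, rfl⟩⟩ := h₂.descends (by simpa using ht)
      · exact hS c hcS hc
      · exact hb rfl hc

/-- Removing a node from the conditioning set keeps a walk active, unless the walk has a collider at
this node. -/
theorem Conn.uncondition {G : Digraph V} {S : Set V} {y a s b t} (h : Conn G (insert y S) a s b t)
    (hy : y ∉ S) :
    Conn G S a s b t ∨ (Conn G S a s y true ∧ Conn G S y true b t) := by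
  induction h with
  | arc e => exact .inl (.arc e)
  | rev e => exact .inl (.rev e)
  | @comp a s v t s' b t' _ _ hv ih₁ ih₂ =>
    by_cases hvy : v = y
    · subst hvy
      obtain ⟨rfl, rfl⟩ := hv.1 (by simp)
      exact .inr ⟨ih₁.elim id And.left, ih₂.elim id And.right⟩
    · have hv' : v ∈ S ↔ (t = true ∧ s' = true) := by rw [← hv]; simp [hvy]
      rcases ih₁ with h₁ | ⟨h₁, h₁'⟩ <;> rcases ih₂ with h₂ | ⟨h₂, h₂'⟩
      · exact .inl (.comp h₁ h₂ hv')
      · exact .inr ⟨.comp h₁ h₂ hv', h₂'⟩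
      · exact .inr ⟨h₁, .comp h₁' h₂ hv'⟩
      -- With colliders at `y` in both halves, only the pieces before the first and after the last
      -- of them are kept.
      · exact .inr ⟨h₁, h₂'⟩

theorem Trail.mono {G G' : Digraph V} (hle : G ≤ G') {S : Set V} {x v d} (h : Trail G S x v d) :
    Trail G' S x v d := by
  induction h with
  | start => exact .start
  | down _ hv e ih => exact .down ih hv (hle e)
  | up _ hv e ih => exact .up ih hv (hle e)

/-! ### Walks and routes -/

theorem IsDAG.asymm {G : Digraph V} (hG : IsDAG G) {a b : V} (h : G.Adj a b) : ¬ G.Adj b a :=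
  fun h' => hG a (.tail (.single h) h')

theorem isActive_iff {G : Digraph V} {S : Set V} {ρ : List V} :
    IsActive G S ρ ↔ ∀ l₁ C l₂, ρ = l₁ ++ C :: l₂ → (IsColliderOcc G l₁ C l₂ ↔ C ∈ S) := by
  unfold IsActive
  refine forall_congr' fun l₁ => forall_congr' fun C => forall_congr' fun l₂ =>
    imp_congr_right fun _ => ?_
  tauto

theorem isColliderOcc_append {G : Digraph V} {l₁ l₂ l₃ : List V} {b C : V} :
    IsColliderOcc G l₁ C (b :: l₂ ++ l₃) ↔ IsColliderOcc G l₁ C (b :: l₂) := by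
  simp [IsColliderOcc]

/-- The activity hypothesis exempts the last node, since its status depends on how the route
continues; this makes induction from the right possible. Acyclicity ensures that the direction of
the last arc is determined by its ends. -/
theorem trail_of_route {G : Digraph V} (hG : IsDAG G) {S : Set V} {x : V} (l : List V) (v : V)
    (hx : (l ++ [v]).head? = some x) (hc : (l ++ [v]).IsChain (Adjacent G))
    (ha : ∀ l₁ C b l₂, l ++ [v] = l₁ ++ C :: b :: l₂ →
      (IsColliderOcc G l₁ C (b :: l₂) ↔ C ∈ S)) :
    ∃ d, Trail G S x v d ∧ (d = true ↔ ∃ A, l.getLast? = some A ∧ G.Adj A v) := by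
  induction l using List.reverseRecOn generalizing v with
  | nil =>
    obtain rfl : v = x := by simpa using hx
    exact ⟨false, .start, by simp⟩
  | append_singleton l u ih =>
    obtain ⟨d, hd, hd'⟩ := ih u (by simpa [List.head?_append] using hx)
      (List.isChain_append.1 hc).1 (fun l₁ C b l₂ h => by
        rw [← ha l₁ C b (l₂ ++ [v]) (by rw [h]; simp)]
        exact (isColliderOcc_append (l₂ := l₂) (l₃ := [v])).symm)
    have hu := ha l u v [] (by simp)
    have huv : Adjacent G u v := (List.isChain_append.1 hc).2.2 u (by simp) v (by simp)
    rcases huv with e | e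
    · refine ⟨true, .down hd (fun hS => ?_) e, by simpa using e⟩
      obtain ⟨A, B, -, hB, -, hBu⟩ := hu.2 hS
      obtain rfl : v = B := by simpa using hB
      exact hG.asymm e hBu
    · refine ⟨false, .up hd ?_ e, by simpa using hG.asymm e⟩
      rw [← hu, hd']
      simp [IsColliderOcc, e]

theorem Trail.route {G : Digraph V} (hG : IsDAG G) {S : Set V} {x v d} (h : Trail G S x v d) :
    ∃ l : List V, (l ++ [v]).head? = some x ∧ (l ++ [v]).IsChain (Adjacent G) ∧
      (d = true ↔ ∃ A, l.getLast? = some A ∧ G.Adj A v) ∧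
      ∀ l₁ C b l₂, l ++ [v] = l₁ ++ C :: b :: l₂ → (IsColliderOcc G l₁ C (b :: l₂) ↔ C ∈ S) := by
  have key : ∀ (l : List V) (v w : V), (l ++ [v]).head? = some x →
      (l ++ [v]).IsChain (Adjacent G) → Adjacent G v w →
      (∀ l₁ C b l₂, l ++ [v] = l₁ ++ C :: b :: l₂ → (IsColliderOcc G l₁ C (b :: l₂) ↔ C ∈ S)) →
      (IsColliderOcc G l v [w] ↔ v ∈ S) →
      ((l ++ [v]) ++ [w]).head? = some x ∧ ((l ++ [v]) ++ [w]).IsChain (Adjacent G) ∧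
      ∀ l₁ C b l₂, (l ++ [v]) ++ [w] = l₁ ++ C :: b :: l₂ →
        (IsColliderOcc G l₁ C (b :: l₂) ↔ C ∈ S) := by
    intro l v w h₁ h₂ hvw h₃ h₄
    refine ⟨by rw [List.head?_append, h₁]; rfl, List.isChain_append.2 ⟨h₂, by simp, ?_⟩, ?_⟩
    · intro a ha b hb
      obtain rfl : v = a := by simpa using ha
      obtain rfl : w = b := by simpa using hb
      exact hvw
    · intro l₁ C b l₂ h
      rcases List.eq_nil_or_concat l₂ with rfl | ⟨l₃, w', rfl⟩
      · have h' : l ++ [v, w] = l₁ ++ [C, b] := by simpa using h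
        obtain ⟨rfl, h''⟩ := List.append_inj' h' rfl
        obtain ⟨rfl, rfl⟩ : v = C ∧ w = b := by simpa using h''
        exact h₄
      · have h' : (l ++ [v]) ++ [w] = (l₁ ++ C :: b :: l₃) ++ [w'] := by simpa using h
        obtain ⟨h'', -⟩ := List.append_inj' h' rfl
        rw [← h₃ l₁ C b l₃ h'', List.concat_eq_append]
        exact isColliderOcc_append (l₂ := l₃) (l₃ := [w'])
  induction h with
  | start =>
    refine ⟨[], rfl, by simp, by simp, fun l₁ C b l₂ h => ?_⟩
    have := congrArg List.length h
    simp at this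
    omega
  | @down v d w _ hv e ih =>
    obtain ⟨l, h₁, h₂, -, h₄⟩ := ih
    obtain ⟨k₁, k₂, k₃⟩ := key l v w h₁ h₂ (.inl e) h₄ (by
      refine iff_of_false ?_ hv
      rintro ⟨A, B, -, hB, -, hBv⟩
      obtain rfl : w = B := by simpa using hB
      exact hG.asymm e hBv)
    exact ⟨l ++ [v], k₁, k₂, by simpa using e, k₃⟩
  | @up v d w _ hv e ih =>
    obtain ⟨l, h₁, h₂, h₃, h₄⟩ := ih
    obtain ⟨k₁, k₂, k₃⟩ := key l v w h₁ h₂ (.inr e) h₄ (by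
      rw [hv, h₃]
      simp [IsColliderOcc, e])
    exact ⟨l ++ [v], k₁, k₂, by simpa using hG.asymm e, k₃⟩

/-- The last occurrence has no successor and is a non-collider, whence `B ∉ S`. At the first one the
starting value `false` plays this role: either way of leaving `A` then requires `A ∉ S`. -/
theorem exists_active_route_iff {G : Digraph V} (hG : IsDAG G) {S : Set V} {A B : V} :
    (∃ ρ, IsRoute G A B ρ ∧ IsActive G S ρ) ↔ B ∉ S ∧ ∃ d, Trail G S A B d := by
  constructor
  · rintro ⟨ρ, ⟨hA, hB, hc⟩, ha⟩
    rw [isActive_iff] at ha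
    obtain ⟨l, rfl⟩ : ∃ l, ρ = l ++ [B] := List.getLast?_eq_some_iff.1 hB
    refine ⟨fun hBS => ?_, ?_⟩
    · obtain ⟨_, _, -, h, -⟩ := (ha l B [] rfl).2 hBS
      simp at h
    · obtain ⟨d, hd, -⟩ := trail_of_route hG l B hA hc fun l₁ C b l₂ h => ha l₁ C (b :: l₂) h
      exact ⟨d, hd⟩
  · rintro ⟨hB, d, h⟩
    obtain ⟨l, h₁, h₂, -, h₄⟩ := h.route hG
    refine ⟨l ++ [B], ⟨h₁, by simp, h₂⟩, isActive_iff.2 fun l₁ C l₂ h => ?_⟩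
    cases l₂ with
    | nil =>
      obtain ⟨-, h'⟩ := List.append_inj' h rfl
      obtain rfl : B = C := by simpa using h'
      exact iff_of_false (by simp [IsColliderOcc]) hB
    | cons b l₂ => exact h₄ l₁ C b l₂ h

theorem separated_iff {G : Digraph V} (hG : IsDAG G) {X Y S : Set V} :
    Separated G X Y S ↔ ∀ A ∈ X, ∀ B ∈ Y, B ∉ S → ∀ d, ¬ Trail G S A B d := by
  unfold Separated
  simp only [exists_active_route_iff hG]
  push Not
  rfl

theorem indepModel_subset {G G' : Digraph V} (hG : IsDAG G) (hG' : IsDAG G')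
    (h : ∀ S x v d, Trail G S x v d → v ∉ S → ∃ d', Trail G' S x v d') :
    indepModel G' ⊆ indepModel G := by
  rintro ⟨X, Y, S⟩ ⟨h₁, h₂, h₃, h₄⟩
  refine ⟨h₁, h₂, h₃, (separated_iff hG).2 fun A hA B hB hBS d hd => ?_⟩
  obtain ⟨d', hd'⟩ := h S A B d hd hBS
  exact (separated_iff hG').1 h₄ A hA B hB hBS d' hd'

theorem indepModel_anti {G G' : Digraph V} (hG : IsDAG G) (hG' : IsDAG G') (hle : G ≤ G') :
    indepModel G' ⊆ indepModel G :=
  indepModel_subset hG hG' fun _ _ _ d h _ => ⟨d, h.mono hle⟩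

/-! ### Covered arc reversal -/

/-- Every `S`-active walk of `G` can be imitated after the reversal of the covered arc `A → B`. -/
theorem Trail.reverse {G : Digraph V} (hG : IsDAG G) {A B : V} (hAB : IsCovered G A B) {S : Set V}
    {x v d} (h : Trail G S x v d) :
    let T := Trail (reverseArc G A B) S x
    (v ≠ A → v ≠ B → T v d) ∧
    (v = A → d = true → T A true ∧ T B true) ∧
    (v = B → d = false → T B false) ∧
    -- Here and in the next clause the walk may just have crossed A → B. The imitation can then
    -- stand at A or at B, and the alternatives record what is available for the next step.
    (v = A → d = false →
      T A false ∨ (T A true ∧ ((B ∈ S ∧ T B true) ∨ (B ∉ S ∧ T B false)))) ∧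
    (v = B → d = true →
      (T A true ∧ T B true) ∨ (A ∉ S ∧ T A false ∧ T B false) ∨ (B ∉ S ∧ T B false)) := by
  intro T
  have hne : A ≠ B := by
    rintro rfl
    exact hG _ (.single hAB.1)
  have hnBA : ¬ G.Adj B A := hG.asymm hAB.1
  have hpar : ∀ p, p ≠ A → (G.Adj p A ↔ G.Adj p B) := fun p hp => by
    have : p ∈ parents G A ↔ p ∈ parents G B \ {A} := by rw [hAB.2]
    simpa [parents, hp] using this
  have hloop : ∀ v, ¬ G.Adj v v := fun v hv => hG v (.single hv)
  have keep : ∀ {p c}, G.Adj p c → ¬ (p = A ∧ c = B) → (reverseArc G A B).Adj p c :=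
    fun e h => .inl ⟨e, h⟩
  have hBA : (reverseArc G A B).Adj B A := .inr ⟨rfl, rfl⟩
  induction h with
  | start =>
    by_cases hA : x = A
    · subst hA
      exact ⟨by simp, by simp, fun h => absurd h hne, fun _ _ => .inl .start, by simp⟩
    · by_cases hB : x = B
      · subst hB
        exact ⟨by simp, by simp, fun _ _ => .start, fun h => absurd h hA, by simp⟩
      · exact ⟨fun _ _ => .start, by simp, fun h => absurd h hB, fun h => absurd h hA, by simp⟩
  | @down v d w _ hv e ih =>
    obtain ⟨i₁, i₂, i₃, i₄, i₅⟩ := ih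
    have out : ∃ d', T v d' := by
      by_cases hA : v = A
      · subst hA
        cases d
        · rcases i₄ rfl rfl with h | h
          exacts [⟨_, h⟩, ⟨_, h.1⟩]
        · exact ⟨_, (i₂ rfl rfl).1⟩
      · by_cases hB : v = B
        · subst hB
          cases d
          · exact ⟨_, i₃ rfl rfl⟩
          · rcases i₅ rfl rfl with h | h | h
            exacts [⟨_, h.2⟩, ⟨_, h.2.2⟩, ⟨_, h.2⟩]
        · exact ⟨_, i₁ hA hB⟩
    obtain ⟨d', hd'⟩ := out
    refine ⟨fun hA hB => .down hd' hv (keep e fun h => hB h.2), ?_, by simp, by simp, ?_⟩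
    · rintro rfl -
      have hvA : v ≠ w := by rintro rfl; exact hloop _ e
      exact ⟨.down hd' hv (keep e fun h => hne h.2),
        .down hd' hv (keep ((hpar v hvA).1 e) fun h => hvA h.1)⟩
    · rintro rfl -
      by_cases hA : v = A
      · subst hA
        cases d
        · rcases i₄ rfl rfl with h | ⟨h, ⟨hB, h'⟩ | ⟨hB, h'⟩⟩
          · exact .inr (.inl ⟨hv, h, .up h (by simpa using hv) hBA⟩)
          · exact .inl ⟨h, h'⟩
          -- The walk went from B to A and straight back; the imitation stays at B.
          · exact .inr (.inr ⟨hB, h'⟩)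
        · exact .inl (i₂ rfl rfl)
      · exact .inl ⟨.down hd' hv (keep ((hpar v hA).2 e) fun h => hA h.1),
          .down hd' hv (keep e fun h => hA h.1)⟩
  | @up v d w _ hv e ih =>
    obtain ⟨i₁, i₂, i₃, i₄, i₅⟩ := ih
    by_cases hA : v = A
    · subst hA
      have hwA : w ≠ v := by rintro rfl; exact hloop _ e
      have hwB : w ≠ B := by rintro rfl; exact hnBA e
      have eA : (reverseArc G v B).Adj w v := keep e fun h => hwA h.1
      have eB : (reverseArc G v B).Adj w B := keep ((hpar w hwA).1 e) fun h => hwA h.1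
      refine ⟨fun _ _ => ?_, by simp, fun h => absurd h hwB, fun h => absurd h hwA, by simp⟩
      cases d
      · rcases i₄ rfl rfl with h | ⟨h, ⟨hB, h'⟩ | ⟨hB, h'⟩⟩
        · exact .up h hv eA
        -- The next node is a common parent of A and B, so the imitation goes there directly from B.
        · exact .up h' (by simpa using hB) eB
        · exact .up h' (by simpa using hB) eB
      · exact .up (i₂ rfl rfl).1 hv eA
    · by_cases hB : v = B
      · subst hB
        have hwB : w ≠ v := by rintro rfl; exact hloop _ e
        by_cases hwA : w = A
        · subst hwA
          refine ⟨by simp, by simp, fun h => absurd h hwB, fun _ _ => ?_, by simp⟩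
          cases d
          · have hvS : v ∉ S := by simpa using hv
            exact .inr ⟨.down (i₃ rfl rfl) hvS hBA, .inr ⟨hvS, i₃ rfl rfl⟩⟩
          · have hvS : v ∈ S := by simpa using hv
            rcases i₅ rfl rfl with h | h | h
            · exact .inr ⟨h.1, .inl ⟨hvS, h.2⟩⟩
            -- The detour A → B ← A is dropped.
            · exact .inl h.2.1
            · exact absurd hvS h.1
        · have eB : (reverseArc G A v).Adj w v := keep e fun h => hwA h.1
          have eA : (reverseArc G A v).Adj w A := keep ((hpar w hwA).2 e) fun h => hwA h.1
          refine ⟨fun _ _ => ?_, by simp, fun h => absurd h hwB, fun h => absurd h hwA, by simp⟩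
          cases d
          · exact .up (i₃ rfl rfl) hv eB
          · rcases i₅ rfl rfl with h | h | h
            · exact .up h.2 hv eB
            · exact .up h.2.1 (by simpa using h.1) eA
            · exact absurd (hv.2 rfl) h.1
      · have ht : T w false := .up (i₁ hA hB) hv (keep e fun h => hB h.2)
        exact ⟨fun _ _ => ht, by simp, fun h _ => h ▸ ht, fun h _ => .inl (h ▸ ht), by simp⟩

/-- Only this inclusion is needed, because along a run it is enough that independence models do not
grow. -/
theorem indepModel_reverseArc {G : Digraph V} (hG : IsDAG G) {A B : V} (hAB : IsCovered G A B)
    (hG' : IsDAG (reverseArc G A B)) : indepModel (reverseArc G A B) ⊆ indepModel G := by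
  refine indepModel_subset hG hG' fun S x v d h hv => ?_
  obtain ⟨i₁, i₂, i₃, i₄, i₅⟩ := h.reverse hG hAB
  by_cases hA : v = A
  · subst hA
    cases d
    · rcases i₄ rfl rfl with h | h
      exacts [⟨_, h⟩, ⟨_, h.1⟩]
    · exact ⟨_, (i₂ rfl rfl).1⟩
  · by_cases hB : v = B
    · subst hB
      cases d
      · exact ⟨_, i₃ rfl rfl⟩
      · rcases i₅ rfl rfl with h | h | h
        exacts [⟨_, h.2⟩, ⟨_, h.2.2⟩, ⟨_, h.2⟩]
    · exact ⟨_, i₁ hA hB⟩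

/-! ### Exchanging two neighbors of an ordering: the walks

In the following lemmas `P` is the set of nodes that precede two neighboring nodes `Y` and `Z`, the
node `Z` has no descendants among them, and `Y` has a descendant in `P ∪ {Z}` that can be reached
without passing through `P`. -/

/-- There is a nonempty walk from `a` to `b` in `G` with `S`-active interior. -/
def Linked (G : Digraph V) (S : Set V) (a b : V) : Prop :=
  ∃ s t, Conn G S a s b t

theorem Linked.symm {G : Digraph V} {S : Set V} {a b : V} : Linked G S a b → Linked G S b a :=
  fun ⟨s, t, h⟩ => ⟨t, s, h.symm⟩

/-- Keeps an existing arc X → Y forced when Z becomes a predecessor of Y: a node without relevant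
descendants can only occur on the walk as a collider. -/
theorem linked_right_of_linked_left {G : Digraph V} {P : Set V} {X Y Z : V}
    (hZ : ∀ c, c ∈ P ∨ c = Y → ¬ Relation.TransGen G.Adj Z c) (hX : X ∈ P)
    (h : Linked G (P \ {X}) X Y) : Linked G (insert Z (P \ {X})) X Y := by
  obtain ⟨s, t, h⟩ := h
  exact ⟨s, t, h.condition (fun c hc => hZ c (.inl hc.1)) (fun _ => hZ X (.inl hX))
    (fun _ => hZ Y (.inr rfl))⟩

/-- The only obstacle to joining the walks is a collider at Y, which is outside the conditioning
set. The descending path to `D` removes it: it ends the walk if `D = Z`, starts it if `D = X`, and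
otherwise gives a detour from Y to the collider `D` and back. -/
theorem linked_of_conn_of_conn {G : Digraph V} {P : Set V} {X Y Z : V} (hY : Y ∉ P)
    (hD : ∃ D, (D = Z ∨ D ∈ P) ∧ ∀ S ⊆ P, Conn G S Y false D true)
    {s t s' t'} (h₁ : Conn G (P \ {X}) X s Y t) (h₂ : Conn G (P \ {X}) Y s' Z t') :
    Linked G (P \ {X}) X Z := by
  by_cases hc : t = true ∧ s' = true
  · obtain ⟨rfl, rfl⟩ := hc
    obtain ⟨D, hDP, hD⟩ := hD
    have hD := hD (P \ {X}) Set.sdiff_subset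
    have hYS : Y ∉ P \ {X} := fun h => hY h.1
    by_cases hDZ : D = Z
    · subst hDZ
      exact ⟨_, _, .comp h₁ hD (by simpa using fun h => absurd h hY)⟩
    · by_cases hDX : D = X
      · subst hDX
        exact ⟨_, _, .comp hD.symm h₂ (by simpa using fun h => absurd h hY)⟩
      · have hDS : D ∈ P \ {X} := ⟨hDP.resolve_left hDZ, hDX⟩
        have h₃ : Conn G (P \ {X}) Y false Y false := .comp hD hD.symm (by simpa using hDS)
        exact ⟨_, _, .comp (.comp h₁ h₃ (by simpa using fun h => absurd h hY)) h₂
          (by simpa using fun h => absurd h hY)⟩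
  · exact ⟨_, _, .comp h₁ h₂ (iff_of_false (fun h => hY h.1) hc)⟩

/-- Keeps an existing arc X → Z forced when Y ceases to be a predecessor of Z; a walk that used Y as
a collider is cut there and rejoined. -/
theorem linked_left_of_linked_right {G : Digraph V} {P : Set V} {X Y Z : V} (hY : Y ∉ P)
    (hD : ∃ D, (D = Z ∨ D ∈ P) ∧ ∀ S ⊆ P, Conn G S Y false D true)
    (h : Linked G (insert Y (P \ {X})) X Z) : Linked G (P \ {X}) X Z := by
  obtain ⟨s, t, h⟩ := h
  rcases h.uncondition (fun h => hY h.1) with h | ⟨h₁, h₂⟩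
  · exact ⟨s, t, h⟩
  · exact linked_of_conn_of_conn hY hD h₁ h₂

/-- Justifies the arc X → Z that covering Y → Z adds because of X → Y. The walk from Y to Z was
active given a set containing X; if it has a collider at X, its final piece already links X to Z. -/
theorem linked_left_of_linked_pair {G : Digraph V} {P : Set V} {X Y Z : V} (hY : Y ∉ P)
    (hD : ∃ D, (D = Z ∨ D ∈ P) ∧ ∀ S ⊆ P, Conn G S Y false D true) (hX : X ∈ P)
    (h : Linked G (P \ {X}) X Y) (h' : Linked G P Y Z) : Linked G (P \ {X}) X Z := by
  obtain ⟨s, t, h⟩ := h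
  obtain ⟨s', t', h'⟩ := h'
  have hP : P = insert X (P \ {X}) := by simp [Set.insert_eq_of_mem hX]
  rw [hP] at h'
  rcases h'.uncondition (by simp) with h₁ | ⟨-, h₂⟩
  · exact linked_of_conn_of_conn hY hD h h₁
  · exact ⟨_, _, h₂⟩

/-- Justifies the arc X → Y that covering Y → Z adds because of X → Z. Both walks have an arrowhead
at Z, since leaving Z downward would reach a forbidden descendant; so they meet in a collider at Z,
which is now conditioned on. -/
theorem linked_right_of_linked_pair {G : Digraph V} {P : Set V} {X Y Z : V} (hY : Y ∉ P)
    (hZ : ∀ c, c ∈ P ∨ c = Y → ¬ Relation.TransGen G.Adj Z c)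
    (hZZ : ¬ Relation.TransGen G.Adj Z Z) (hX : X ∈ P)
    (h : Linked G (insert Y (P \ {X})) X Z) (h' : Linked G P Y Z) :
    Linked G (insert Z (P \ {X})) X Y := by
  obtain ⟨s, t, h⟩ := h
  obtain ⟨s', t', h'⟩ := h'
  obtain rfl : t = true := by
    by_contra ht
    obtain ⟨c, hc, (rfl | hcS) | ⟨rfl, -⟩⟩ := h.symm.descends (by simpa using ht)
    · exact hZ c (.inr rfl) hc
    · exact hZ c (.inl hcS.1) hc
    · exact hZ c (.inl hX) hc
  obtain rfl : t' = true := by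
    by_contra ht
    obtain ⟨c, hc, hcS | ⟨rfl, -⟩⟩ := h'.symm.descends (by simpa using ht)
    · exact hZ c (.inl hcS) hc
    · exact hZ c (.inr rfl) hc
  have cond : ∀ {a s b t}, Conn G (P \ {X}) a s b t → (a ∈ P ∨ a = Y) →
      (b ∈ P ∨ b = Y ∨ b = Z) → Conn G (insert Z (P \ {X})) a s b t := by
    intro a s b t h ha hb
    refine h.condition (fun c hc => hZ c (.inl hc.1)) (fun _ => hZ a ha) (fun _ => ?_)
    rcases hb with hb | hb | rfl
    exacts [hZ b (.inl hb), hZ b (.inr hb), hZZ]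
  have hP : P = insert X (P \ {X}) := by simp [Set.insert_eq_of_mem hX]
  rcases h.uncondition (fun h => hY h.1) with h | ⟨h, -⟩
  · rw [hP] at h'
    rcases h'.uncondition (by simp) with h' | ⟨h', -⟩
    · exact ⟨_, _, .comp (cond h (.inl hX) (.inr (.inr rfl)))
        (cond h' (.inr rfl) (.inr (.inr rfl))).symm (by simp)⟩
    · exact ⟨_, _, (cond h' (.inr rfl) (.inl hX)).symm⟩
  · exact ⟨_, _, cond h (.inl hX) (.inr (.inl rfl))⟩

/-! ### Positions in node orderings -/

theorem IsNodeOrdering.swap {l₁ l₂ : List V} {Y Z : V}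
    (h : IsNodeOrdering (l₁ ++ Y :: Z :: l₂)) : IsNodeOrdering (l₁ ++ Z :: Y :: l₂) := by
  have hp : (l₁ ++ Y :: Z :: l₂).Perm (l₁ ++ Z :: Y :: l₂) :=
    (List.Perm.swap Z Y l₂).append_left l₁
  exact ⟨hp.nodup_iff.1 h.1, fun v => hp.mem_iff.1 (h.2 v)⟩

section Order

variable [DecidableEq V] {α β β₀ : List V}

theorem LeftOf.trans {A B C : V} (h : LeftOf β A B) (h' : LeftOf β B C) : LeftOf β A C :=
  Nat.lt_trans h h'

theorem LeftOf.asymm {A B : V} (h : LeftOf β A B) : ¬ LeftOf β B A :=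
  Nat.lt_asymm h

theorem LeftOf.ne {A B : V} (h : LeftOf β A B) : A ≠ B := by
  rintro rfl
  exact Nat.lt_irrefl _ h

theorem IsNodeOrdering.total (hβ : IsNodeOrdering β) {A B : V} (h : A ≠ B) :
    LeftOf β A B ∨ LeftOf β B A :=
  Nat.lt_or_gt_of_ne fun h' => h ((List.idxOf_inj (hβ.2 A)).1 h')

theorem Consistent.leftOf {G : Digraph V} (h : Consistent G β) {A B : V}
    (hAB : Relation.TransGen G.Adj A B) : LeftOf β A B := by
  induction hAB with
  | single e => exact h _ _ e
  | tail _ e ih => exact ih.trans (h _ _ e)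

theorem Consistent.isDAG {G : Digraph V} (h : Consistent G β) : IsDAG G :=
  fun _ hv => (h.leftOf hv).ne rfl

theorem Consistent.mono {G K : Digraph V} (hK : Consistent K β) (hle : G ≤ K) : Consistent G β :=
  fun A B h => hK A B (hle h)

theorem idxOf_middle {l₁ l₂ : List V} {Y Z : V} (h : (l₁ ++ Y :: Z :: l₂).Nodup) :
    (l₁ ++ Y :: Z :: l₂).idxOf Y = l₁.length ∧ (l₁ ++ Y :: Z :: l₂).idxOf Z = l₁.length + 1 := by
  have h' : Y ∉ l₁ ∧ Z ∉ l₁ ∧ Y ≠ Z := by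
    simp only [List.nodup_append, List.nodup_cons, List.mem_cons] at h
    refine ⟨fun hY => h.2.2 Y hY Y (.inl rfl) rfl, fun hZ => h.2.2 Z hZ Z (.inr (.inl rfl)) rfl,
      fun hYZ => h.2.1.1 (.inl hYZ)⟩
  simp [List.idxOf_append, h'.1, h'.2.1, h'.2.2, Nat.add_comm]

theorem idxOf_swap {l₁ l₂ : List V} {Y Z A : V} (hY : A ≠ Y) (hZ : A ≠ Z) :
    (l₁ ++ Z :: Y :: l₂).idxOf A = (l₁ ++ Y :: Z :: l₂).idxOf A := by
  simp [List.idxOf_append, hY.symm, hZ.symm]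

theorem leftOf_middle {l₁ l₂ : List V} {Y Z : V} (h : IsNodeOrdering (l₁ ++ Y :: Z :: l₂)) :
    LeftOf (l₁ ++ Y :: Z :: l₂) Y Z := by
  have := idxOf_middle h.1
  unfold LeftOf
  omega

theorem leftOf_right_iff {l₁ l₂ : List V} {Y Z A : V} (h : IsNodeOrdering (l₁ ++ Y :: Z :: l₂)) :
    LeftOf (l₁ ++ Y :: Z :: l₂) A Z ↔ A = Y ∨ LeftOf (l₁ ++ Y :: Z :: l₂) A Y := by
  have hm := idxOf_middle h.1
  have hi := List.idxOf_inj (y := Y) (h.2 A)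
  unfold LeftOf
  rw [← hi]
  omega

theorem leftOf_swap {l₁ l₂ : List V} {Y Z : V} (h : IsNodeOrdering (l₁ ++ Y :: Z :: l₂)) (A B : V) :
    LeftOf (l₁ ++ Z :: Y :: l₂) A B ↔
      (LeftOf (l₁ ++ Y :: Z :: l₂) A B ∧ ¬ (A = Y ∧ B = Z)) ∨ (A = Z ∧ B = Y) := by
  have hYZ : Y ≠ Z := (leftOf_middle h).ne
  have hm := idxOf_middle h.1
  have hm' := idxOf_middle h.swap.1
  have key : ∀ A, A ≠ Y → A ≠ Z → (l₁ ++ Z :: Y :: l₂).idxOf A = (l₁ ++ Y :: Z :: l₂).idxOf A ∧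
      (l₁ ++ Y :: Z :: l₂).idxOf A ≠ l₁.length ∧ (l₁ ++ Y :: Z :: l₂).idxOf A ≠ l₁.length + 1 := by
    intro A hY hZ
    refine ⟨idxOf_swap hY hZ, ?_, ?_⟩
    · rw [← hm.1, Ne, List.idxOf_inj (h.2 A)]
      exact hY
    · rw [← hm.2, Ne, List.idxOf_inj (h.2 A)]
      exact hZ
  have hA := key A
  have hB := key B
  unfold LeftOf
  by_cases hAY : A = Y
  · subst hAY
    by_cases hBY : B = A
    · subst hBY
      simp [hYZ]
    · by_cases hBZ : B = Z
      · subst hBZ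
        simp [hBY]
        omega
      · have hB := hB hBY hBZ
        simp only [hBZ, hBY, and_false, not_false_eq_true, and_true, or_false]
        omega
  · by_cases hAZ : A = Z
    · subst hAZ
      by_cases hBY : B = Y
      · subst hBY
        simp
        omega
      · by_cases hBZ : B = A
        · subst hBZ
          simp [hBY]
        · have hB := hB hBY hBZ
          simp only [hBZ, hBY, and_false, not_false_eq_true, and_true, or_false]
          omega
    · have hA := hA hAY hAZ
      by_cases hBY : B = Y
      · subst hBY
        simp [hAY, hAZ]
        omega
      · by_cases hBZ : B = Z
        · subst hBZ
          simp [hAY, hAZ]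
          omega
        · have hB := hB hBY hBZ
          simp only [hAY, hAZ, false_and, not_false_eq_true, and_true, or_false]
          omega

theorem eq_of_leftOf_imp (hα : IsNodeOrdering α) (hβ : IsNodeOrdering β)
    (h : ∀ A B, LeftOf β A B → LeftOf α A B) : β = α := by
  have pw : ∀ {l : List V}, l.Nodup → l.Pairwise (LeftOf l) := fun {l} hl => by
    rw [List.pairwise_iff_getElem]
    intro i j hi hj hij
    unfold LeftOf
    rwa [hl.idxOf_getElem, hl.idxOf_getElem]
  have hp : β.Perm α := (List.perm_ext_iff_of_nodup hβ.1 hα.1).2 fun v =>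
    iff_of_true (hβ.2 v) (hα.2 v)
  exact hp.eq_of_pairwise (fun a b _ _ h h' => absurd h' h.asymm)
    ((pw hβ.1).imp fun {a b} => h a b) (pw hα.1)

/-! ### The ordering constructed first -/

/-- The property of the ordering returned by Construct β: every node that is to the left of `U` in
`β`, but to the right of `U` in `α`, has a child that is not to the right of `U` in `β`. -/
def IsGreedy (G : Digraph V) (α β : List V) : Prop :=
  ∀ W U, LeftOf β W U → LeftOf α U W → ∃ U', G.Adj W U' ∧ (U' = U ∨ LeftOf β U' U)

/-- Greediness gives `Y` a child not to the right of `Z` in `β₀`. If this child is to the left of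
`Y` in `α`, it is the required node; otherwise the argument is repeated from it. All interior nodes
are to the right of `Y` in `α`, hence outside `S`. -/
theorem IsGreedy.exists_descendant {G : Digraph V} (hα : IsNodeOrdering α)
    (hc : Consistent G β₀) (hg : IsGreedy G α β₀) {Y Z : V} (hYZ : LeftOf β₀ Y Z)
    (hZY : LeftOf α Z Y) :
    ∃ D, LeftOf α D Y ∧ (D = Z ∨ LeftOf β₀ D Z) ∧
      ∀ S : Set V, (∀ c ∈ S, LeftOf α c Y) → Conn G S Y false D true := by
  -- The bound `n` on the distance to the right end of `β₀` drops with each child, because `β₀` is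
  -- consistent with `G`.
  suffices H : ∀ n W, β₀.length - β₀.idxOf W ≤ n → LeftOf β₀ W Z →
      (W = Y ∨ (LeftOf α Y W ∧ ∀ S : Set V, (∀ c ∈ S, LeftOf α c Y) → Conn G S Y false W true)) →
      ∃ D, LeftOf α D Y ∧ (D = Z ∨ LeftOf β₀ D Z) ∧
        ∀ S : Set V, (∀ c ∈ S, LeftOf α c Y) → Conn G S Y false D true from
    H _ Y le_rfl hYZ (.inl rfl)
  intro n
  induction n with
  | zero =>
    intro W hW hWZ
    have := List.idxOf_le_length (a := Z) (l := β₀)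
    unfold LeftOf at hWZ
    omega
  | succ n ih =>
    intro W hW hWZ hWY
    have hZW : LeftOf α Z W := by
      rcases hWY with rfl | hWY
      exacts [hZY, hZY.trans hWY.1]
    obtain ⟨U, hWU, hUZ⟩ := hg W Z hWZ hZW
    have path : ∀ S : Set V, (∀ c ∈ S, LeftOf α c Y) → Conn G S Y false U true := by
      intro S hS
      rcases hWY with rfl | ⟨hYW, hWY⟩
      · exact .arc hWU
      · refine .comp (hWY S hS) (.arc hWU) ?_
        simpa using fun h => (hS W h).asymm hYW
    by_cases hUY : LeftOf α U Y
    · exact ⟨U, hUY, hUZ, path⟩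
    · have hUZ' : LeftOf β₀ U Z := hUZ.resolve_left fun h => hUY (h ▸ hZY)
      refine ih U ?_ hUZ' ?_
      · have := hc W U hWU
        have := List.idxOf_le_length (a := Z) (l := β₀)
        unfold LeftOf at *
        omega
      · by_cases h : U = Y
        · exact .inl h
        · exact .inr ⟨(hα.total h).resolve_left hUY, path⟩

/-! ### The orderings during Method B2 -/

/-- The ordering `β` when a node is to be selected: the nodes considered before, `D`, are those that
are rightmost in `α`; they are rightmost in `β` too and ordered as in `α`, the others are ordered as
in `β₀`. -/
structure IsSelectOrder (α β₀ β : List V) (D : Finset V) : Prop where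
  ordering : IsNodeOrdering β
  upper : ∀ A B, B ∈ D → LeftOf α B A → A ∈ D
  left : ∀ A B, A ∉ D → B ∉ D → LeftOf β A B → LeftOf β₀ A B
  mid : ∀ A B, A ∉ D → B ∈ D → LeftOf β A B
  right : ∀ A B, A ∈ D → B ∈ D → LeftOf β A B → LeftOf α A B

/-- The ordering `β` while `Y` is being percolated. -/
structure IsPercolateOrder (α β₀ β : List V) (D : Finset V) (Y : V) : Prop where
  ordering : IsNodeOrdering β
  mem : Y ∈ D
  first : ∀ B, B ∈ D → B ≠ Y → LeftOf α Y B
  upper : ∀ A B, B ∈ D → LeftOf α B A → A ∈ D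
  left : ∀ A B, A ∉ D → B ∉ D → LeftOf β A B → LeftOf β₀ A B
  mid : ∀ A B, A ∉ D → B ∈ D → B ≠ Y → LeftOf β A B
  right : ∀ A B, A ∈ D → B ∈ D → A ≠ Y → B ≠ Y → LeftOf β A B → LeftOf α A B
  before : ∀ B, B ∈ D → B ≠ Y → LeftOf β Y B
  passed : ∀ A, A ∉ D → LeftOf β₀ A Y → LeftOf β A Y

theorem IsSelectOrder.percolate {D : Finset V} (hα : IsNodeOrdering α)
    (h : IsSelectOrder α β₀ β D) {Y : V} (hY : IsRightmost α (fun v => v ∉ D) Y) :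
    IsPercolateOrder α β₀ β (insert Y D) Y where
  ordering := h.ordering
  mem := Finset.mem_insert_self _ _
  first B hB hBY := by
    have hBD := (Finset.mem_insert.1 hB).resolve_left hBY
    exact (hα.total hBY.symm).resolve_right fun h' => hY.1 (h.upper Y B hBD h')
  upper A B hB hBA := by
    rw [Finset.mem_insert] at hB ⊢
    by_contra! hA
    rcases hB with rfl | hB
    · exact hBA.asymm (hY.2 A hA.2 hA.1)
    · exact hA.2 (h.upper A B hB hBA)
  left A B hA hB := by
    rw [Finset.mem_insert, not_or] at hA hB
    exact h.left A B hA.2 hB.2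
  mid A B hA hB hBY := by
    rw [Finset.mem_insert] at hA hB
    exact h.mid A B (fun h => hA (.inr h)) (hB.resolve_left hBY)
  right A B hA hB hAY hBY := by
    rw [Finset.mem_insert] at hA hB
    exact h.right A B (hA.resolve_left hAY) (hB.resolve_left hBY)
  before B hB hBY := by
    rw [Finset.mem_insert] at hB
    exact h.mid Y B hY.1 (hB.resolve_left hBY)
  passed A hA hAY := by
    rw [Finset.mem_insert, not_or] at hA
    by_contra hn
    exact hAY.asymm (h.left Y A hY.1 hA.2 ((h.ordering.total hA.1).resolve_left hn))

theorem IsPercolateOrder.select {D : Finset V} (hα : IsNodeOrdering α) {Y : V}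
    (h : IsPercolateOrder α β₀ β D Y)
    (hend : ∀ l₁ Z l₂, β = l₁ ++ Y :: Z :: l₂ → ¬ LeftOf α Z Y) :
    IsSelectOrder α β₀ β D where
  ordering := h.ordering
  upper := h.upper
  left := h.left
  mid A B hA hB := by
    by_cases hBY : B = Y
    · subst hBY
      by_contra hn
      have hAB : A ≠ B := fun h' => hA (h' ▸ hB)
      have hBA : LeftOf β B A := (h.ordering.total hAB).resolve_left hn
      obtain ⟨l₁, l₂, hβ⟩ := List.append_of_mem (h.ordering.2 B)
      cases l₂ with
      | nil =>
        have hmem : A ∈ l₁ := by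
          have := h.ordering.2 A
          rw [hβ] at this
          simpa [hAB] using this
        have hnd := h.ordering.1
        rw [hβ] at hnd
        have hB' : B ∉ l₁ := fun h => (List.nodup_append.1 hnd).2.2 B h B (by simp) rfl
        have : l₁.idxOf A < l₁.length := List.idxOf_lt_length_iff.2 hmem
        unfold LeftOf at hBA
        rw [hβ, List.idxOf_append_of_notMem hB', List.idxOf_append_of_mem hmem] at hBA
        omega
      | cons Z l₂ =>
        have hord := h.ordering
        rw [hβ] at hord
        -- Percolation stopped at `Z`, so `Z` has been considered before; every node outside `D` is
        -- then to the left of `Z`, and so to the left of its left neighbor `B`.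
        have hZB : Z ≠ B := (leftOf_middle hord).ne.symm
        have hZD : Z ∈ D :=
          h.upper Z B hB ((hα.total hZB).resolve_left (hend l₁ Z l₂ hβ))
        have hAZ := h.mid A Z hA hZD hZB
        rw [hβ, leftOf_right_iff hord, ← hβ] at hAZ
        exact hAZ.elim hAB hn
    · exact h.mid A B hA hB hBY
  right A B hA hB hAB := by
    by_cases hBY : B = Y
    · subst hBY
      exact absurd hAB (h.before A hA hAB.ne).asymm
    · by_cases hAY : A = Y
      · subst hAY
        exact h.first B hB hBY
      · exact h.right A B hA hB hAY hBY hAB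

theorem IsPercolateOrder.notMem {D : Finset V} {Y Z : V} (h : IsPercolateOrder α β₀ β D Y)
    (hZ : LeftOf α Z Y) : Z ∉ D :=
  fun hD => (h.first Z hD hZ.ne).asymm hZ

theorem IsPercolateOrder.swap {D : Finset V} {l₁ l₂ : List V} {Y Z : V}
    (h : IsPercolateOrder α β₀ (l₁ ++ Y :: Z :: l₂) D Y) (hZ : LeftOf α Z Y) :
    IsPercolateOrder α β₀ (l₁ ++ Z :: Y :: l₂) D Y where
  ordering := h.ordering.swap
  mem := h.mem
  first := h.first
  upper := h.upper
  left A B hA hB hAB := by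
    rcases (leftOf_swap h.ordering A B).1 hAB with h' | ⟨-, rfl⟩
    · exact h.left A B hA hB h'.1
    · exact absurd h.mem hB
  mid A B hA hB hBY :=
    (leftOf_swap h.ordering A B).2 (.inl ⟨h.mid A B hA hB hBY, fun h' => hA (h'.1 ▸ h.mem)⟩)
  right A B hA hB hAY hBY hAB := by
    rcases (leftOf_swap h.ordering A B).1 hAB with h' | ⟨-, rfl⟩
    · exact h.right A B hA hB hAY hBY h'.1
    · exact absurd rfl hBY
  before B hB hBY :=
    (leftOf_swap h.ordering Y B).2 (.inl ⟨h.before B hB hBY, fun h' => h.notMem hZ (h'.2 ▸ hB)⟩)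
  passed A hA hAY :=
    (leftOf_swap h.ordering A Y).2 (.inl ⟨h.passed A hA hAY, fun h' => hA (h'.1 ▸ h.mem)⟩)

end Order

/-! ### Coverings -/

/-- The graph in which covering `Y → Z` results. -/
def coveringGraph (G : Digraph V) (Y Z : V) : Digraph V where
  Adj A B := G.Adj A B ∨ (G.Adj A Y ∧ B = Z) ∨ (G.Adj A Z ∧ A ≠ Y ∧ B = Y)

theorem isCovering_coveringGraph {G : Digraph V} (hG : IsDAG G) {Y Z : V} (h : G.Adj Y Z) :
    IsCovering G Y Z (coveringGraph G Y Z) := by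
  have hYZ : Y ≠ Z := by
    rintro rfl
    exact hG _ (.single h)
  refine ⟨⟨fun A B hAB => .inl hAB, .inl h, ?_⟩, ?_⟩
  · ext A
    have hY : ¬ G.Adj Y Y := fun h => hG _ (.single h)
    simp only [parents, coveringGraph, Set.mem_ofPred_eq, Set.mem_sdiff, Set.mem_singleton_iff,
      hYZ, hYZ.symm, and_false, and_true, false_or, or_false]
    constructor
    · rintro (h | h)
      · exact ⟨.inr h, by rintro rfl; exact hY h⟩
      · exact ⟨.inl h.1, h.2⟩
    · rintro ⟨h | h, h'⟩
      exacts [.inr ⟨h, h'⟩, .inl h]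
  · rintro K ⟨hle, -, hK⟩ A B (hAB | ⟨hAY, rfl⟩ | ⟨hAZ, hA, rfl⟩)
    · exact hle hAB
    · have hA : A ∈ parents K B \ {Y} := hK ▸ hle hAY
      exact hA.1
    · have hA : A ∈ parents K B := hK ▸ ⟨hle hAZ, hA⟩
      exact hA

theorem IsCovering.eq {G K : Digraph V} (hG : IsDAG G) {Y Z : V} (h : G.Adj Y Z)
    (hK : IsCovering G Y Z K) : K = coveringGraph G Y Z :=
  hK.unique (isCovering_coveringGraph hG h)

section Order

variable [DecidableEq V] {α β β₀ : List V}

/-! ### Exchanging two neighbors of an ordering: the graphs -/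

/-- `G` is consistent with `β`, and each of its arcs is needed in every graph that is consistent with
`β` and whose independence model is contained in that of `G₀`. -/
def IsNecessary (G₀ : Digraph V) (β : List V) (G : Digraph V) : Prop :=
  ∀ A B, G.Adj A B → LeftOf β A B ∧ Linked G₀ ({C | LeftOf β C B} \ {A}) A B

theorem IsNecessary.consistent {G₀ G : Digraph V} (h : IsNecessary G₀ β G) : Consistent G β :=
  fun A B hAB => (h A B hAB).1

theorem Consistent.isNecessary {G : Digraph V} (h : Consistent G β) : IsNecessary G β G :=
  fun A B hAB => ⟨h A B hAB, _, _, .arc hAB⟩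

/-- The orderings that Construct β may return. -/
structure IsStartOrder (G₀ : Digraph V) (α β₀ : List V) : Prop where
  ordering : IsNodeOrdering β₀
  consistent : Consistent G₀ β₀
  greedy : IsGreedy G₀ α β₀

/-- Supplies the two facts on `G₀` that the walk lemmas assume. Both are read off from `β₀`, whose
order the nodes outside `D` still follow. -/
theorem IsPercolateOrder.descendants {G₀ : Digraph V} (hα : IsNodeOrdering α)
    (hβ₀ : IsStartOrder G₀ α β₀) {D : Finset V} {l₁ l₂ : List V} {Y Z : V}
    (h : IsPercolateOrder α β₀ (l₁ ++ Y :: Z :: l₂) D Y) (hZ : LeftOf α Z Y) :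
    (∀ c, c ∈ {C | LeftOf (l₁ ++ Y :: Z :: l₂) C Y} ∨ c = Y → ¬ Relation.TransGen G₀.Adj Z c) ∧
    ∃ D, (D = Z ∨ D ∈ {C | LeftOf (l₁ ++ Y :: Z :: l₂) C Y}) ∧
      ∀ S ⊆ {C | LeftOf (l₁ ++ Y :: Z :: l₂) C Y}, Conn G₀ S Y false D true := by
  have hYZ := leftOf_middle h.ordering
  have hZD := h.notMem hZ
  have hP : ∀ c, LeftOf (l₁ ++ Y :: Z :: l₂) c Y → c ∉ D := fun c hc hcD =>
    (h.before c hcD hc.ne).asymm hc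
  -- `Y` only moves to the right, so a node preceding it in `β₀` could not now follow it.
  have hYZ₀ : LeftOf β₀ Y Z := (hβ₀.ordering.total hYZ.ne).resolve_right fun h' =>
    (h.passed Z hZD h').asymm hYZ
  constructor
  · intro c hc hZc
    refine (hβ₀.consistent.leftOf hZc).asymm ?_
    rcases hc with hc | rfl
    · exact h.left c Z (hP c hc) hZD (LeftOf.trans hc hYZ)
    · exact hYZ₀
  · obtain ⟨U, hUY, hUZ, hU⟩ := hβ₀.greedy.exists_descendant hα hβ₀.consistent hYZ₀ hZ
    refine ⟨U, ?_, fun S hS => hU S fun c hc => ?_⟩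
    · by_cases hUZ' : U = Z
      · exact .inl hUZ'
      · have hUZ₀ := hUZ.resolve_left hUZ'
        have := (h.ordering.total hUZ').resolve_right fun h' =>
          (h.left Z U hZD (h.notMem hUY) h').asymm hUZ₀
        exact .inr (((leftOf_right_iff h.ordering).1 this).resolve_left hUY.ne)
    · have hcY : LeftOf _ c Y := hS hc
      exact (hα.total hcY.ne).resolve_right fun h' => hP c hcY (h.upper c Y h.mem h')

theorem setOf_leftOf_right {l₁ l₂ : List V} {Y Z : V} (h : IsNodeOrdering (l₁ ++ Y :: Z :: l₂)) :
    {C | LeftOf (l₁ ++ Y :: Z :: l₂) C Z} = insert Y {C | LeftOf (l₁ ++ Y :: Z :: l₂) C Y} :=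
  Set.ext fun _ => leftOf_right_iff h

theorem setOf_leftOf_swap_left {l₁ l₂ : List V} {Y Z : V}
    (h : IsNodeOrdering (l₁ ++ Y :: Z :: l₂)) :
    {C | LeftOf (l₁ ++ Z :: Y :: l₂) C Z} = {C | LeftOf (l₁ ++ Y :: Z :: l₂) C Y} := by
  have hYZ := (leftOf_middle h).ne
  ext C
  simp only [Set.mem_ofPred_eq, leftOf_swap h, leftOf_right_iff h, hYZ.symm, and_true, and_false,
    or_false]
  constructor
  · rintro ⟨rfl | h₁, h₂⟩
    exacts [absurd rfl h₂, h₁]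
  · exact fun h₁ => ⟨.inr h₁, h₁.ne⟩

theorem setOf_leftOf_swap_of_ne {l₁ l₂ : List V} {Y Z B : V}
    (h : IsNodeOrdering (l₁ ++ Y :: Z :: l₂)) (hY : B ≠ Y) (hZ : B ≠ Z) :
    {C | LeftOf (l₁ ++ Z :: Y :: l₂) C B} = {C | LeftOf (l₁ ++ Y :: Z :: l₂) C B} := by
  ext C
  simp [leftOf_swap h, hY, hZ]

/-- The exchange alters the predecessors of two nodes only: `Z` loses `Y`, and `Y` gains `Z`. -/
theorem IsNecessary.swap_adj {G₀ G : Digraph V} (hα : IsNodeOrdering α)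
    (hβ₀ : IsStartOrder G₀ α β₀) {D : Finset V} {l₁ l₂ : List V} {Y Z : V}
    (h : IsPercolateOrder α β₀ (l₁ ++ Y :: Z :: l₂) D Y) (hZ : LeftOf α Z Y)
    (hG : IsNecessary G₀ (l₁ ++ Y :: Z :: l₂) G) {A B : V} (hAB : G.Adj A B)
    (hne : ¬ (A = Y ∧ B = Z)) :
    LeftOf (l₁ ++ Z :: Y :: l₂) A B ∧
      Linked G₀ ({C | LeftOf (l₁ ++ Z :: Y :: l₂) C B} \ {A}) A B := by
  obtain ⟨hdesc, hU⟩ := h.descendants hα hβ₀ hZ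
  obtain ⟨hlt, hlk⟩ := hG A B hAB
  refine ⟨(leftOf_swap h.ordering A B).2 (.inl ⟨hlt, hne⟩), ?_⟩
  have hY : Y ∉ {C | LeftOf (l₁ ++ Y :: Z :: l₂) C Y} := fun h => LeftOf.ne h rfl
  by_cases hBZ : B = Z
  · subst hBZ
    have hAY : A ≠ Y := fun h => hne ⟨h, rfl⟩
    rw [setOf_leftOf_swap_left h.ordering]
    rw [setOf_leftOf_right h.ordering, ← Set.insert_sdiff_singleton_comm hAY.symm] at hlk
    exact linked_left_of_linked_right hY hU hlk
  · by_cases hBY : B = Y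
    · subst hBY
      have hAZ : A ≠ Z := by
        rintro rfl
        exact hlt.asymm (leftOf_middle h.ordering)
      rw [setOf_leftOf_right h.ordering.swap, setOf_leftOf_swap_left h.ordering,
        ← Set.insert_sdiff_singleton_comm hAZ.symm]
      exact linked_right_of_linked_left hdesc hlt hlk
    · rwa [setOf_leftOf_swap_of_ne h.ordering hBY hBZ]

theorem IsNecessary.swap {G₀ G : Digraph V} (hα : IsNodeOrdering α)
    (hβ₀ : IsStartOrder G₀ α β₀) {D : Finset V} {l₁ l₂ : List V} {Y Z : V}
    (h : IsPercolateOrder α β₀ (l₁ ++ Y :: Z :: l₂) D Y) (hZ : LeftOf α Z Y)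
    (hG : IsNecessary G₀ (l₁ ++ Y :: Z :: l₂) G) (hYZ : ¬ G.Adj Y Z) :
    IsNecessary G₀ (l₁ ++ Z :: Y :: l₂) G :=
  fun _ _ hAB => hG.swap_adj hα hβ₀ h hZ hAB fun h' => hYZ (h'.1 ▸ h'.2 ▸ hAB)

theorem IsNecessary.consistent_coveringGraph {G₀ G : Digraph V} {l₁ l₂ : List V} {Y Z : V}
    (h : IsNodeOrdering (l₁ ++ Y :: Z :: l₂)) (hG : IsNecessary G₀ (l₁ ++ Y :: Z :: l₂) G) :
    Consistent (coveringGraph G Y Z) (l₁ ++ Y :: Z :: l₂) := by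
  rintro A B (hAB | ⟨hAY, rfl⟩ | ⟨hAZ, hA, rfl⟩)
  · exact (hG A B hAB).1
  · exact (hG A Y hAY).1.trans (leftOf_middle h)
  · exact ((leftOf_right_iff h).1 (hG A Z hAZ).1).resolve_left hA

/-- Old arcs are handled as in a plain exchange and added arcs by splicing. For the reversed arc,
the conditioning set is the same before and after, namely the predecessors of `Y` before the
exchange. -/
theorem IsNecessary.reverse_coveringGraph {G₀ G : Digraph V} (hα : IsNodeOrdering α)
    (hβ₀ : IsStartOrder G₀ α β₀) {D : Finset V} {l₁ l₂ : List V} {Y Z : V}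
    (h : IsPercolateOrder α β₀ (l₁ ++ Y :: Z :: l₂) D Y) (hZ : LeftOf α Z Y)
    (hG : IsNecessary G₀ (l₁ ++ Y :: Z :: l₂) G) (hYZ : G.Adj Y Z) :
    IsNecessary G₀ (l₁ ++ Z :: Y :: l₂) (reverseArc (coveringGraph G Y Z) Y Z) := by
  obtain ⟨hdesc, hU⟩ := h.descendants hα hβ₀ hZ
  have hY : Y ∉ {C | LeftOf (l₁ ++ Y :: Z :: l₂) C Y} := fun h => LeftOf.ne h rfl
  have hlk : Linked G₀ {C | LeftOf (l₁ ++ Y :: Z :: l₂) C Y} Y Z := by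
    have := (hG Y Z hYZ).2
    rwa [setOf_leftOf_right h.ordering, Set.insert_sdiff_of_mem _ (Set.mem_singleton _),
      Set.sdiff_singleton_eq_self hY] at this
  rintro A B (⟨hAB | ⟨hAY, rfl⟩ | ⟨hAZ, hA, rfl⟩, hne⟩ | ⟨rfl, rfl⟩)
  · exact hG.swap_adj hα hβ₀ h hZ hAB hne
  · obtain ⟨hlt, hl⟩ := hG A Y hAY
    refine ⟨(leftOf_swap h.ordering _ _).2 (.inl ⟨hlt.trans (leftOf_middle h.ordering), hne⟩), ?_⟩
    rw [setOf_leftOf_swap_left h.ordering]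
    exact linked_left_of_linked_pair hY hU hlt hl hlk
  · obtain ⟨hlt, hl⟩ := hG A Z hAZ
    have hlt' := ((leftOf_right_iff h.ordering).1 hlt).resolve_left hA
    refine ⟨(leftOf_swap h.ordering _ _).2 (.inl ⟨hlt', fun h => hA h.1⟩), ?_⟩
    rw [setOf_leftOf_right h.ordering, ← Set.insert_sdiff_singleton_comm (Ne.symm hA)] at hl
    rw [setOf_leftOf_right h.ordering.swap, setOf_leftOf_swap_left h.ordering,
      ← Set.insert_sdiff_singleton_comm hlt.ne.symm]
    exact linked_right_of_linked_pair hY hdesc (fun h => hβ₀.consistent.isDAG _ h) hlt' hl hlk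
  · refine ⟨(leftOf_swap h.ordering _ _).2 (.inr ⟨rfl, rfl⟩), ?_⟩
    have hA : A ∉ {C | LeftOf (l₁ ++ B :: A :: l₂) C B} := fun h' =>
      (leftOf_middle h.ordering).asymm h'
    rw [setOf_leftOf_right h.ordering.swap, setOf_leftOf_swap_left h.ordering,
      Set.insert_sdiff_of_mem _ (Set.mem_singleton _), Set.sdiff_singleton_eq_self hA]
    exact hlk.symm

/-- A graph all of whose arcs are needed is a subgraph of every graph that is consistent with the
ordering and whose independence model is contained in that of `G₀`. -/
theorem IsNecessary.le {G₀ G H : Digraph V} (hG₀ : IsDAG G₀)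
    (hG : IsNecessary G₀ α G) (hH : Consistent H α) (hHG : indepModel H ⊆ indepModel G₀) :
    G ≤ H := by
  intro X Y hXY
  obtain ⟨hlt, s, t, hc⟩ := hG X Y hXY
  by_contra hn
  obtain ⟨S, hS⟩ : ∃ S, S = {C | LeftOf α C Y} \ {X} := ⟨_, rfl⟩
  rw [← hS] at hc
  have hmS : ∀ C, C ∈ S ↔ LeftOf α C Y ∧ C ≠ X := fun C => by rw [hS]; rfl
  have hXS : X ∉ S := fun h => ((hmS X).1 h).2 rfl
  have hYS : Y ∉ S := fun h => LeftOf.ne ((hmS Y).1 h).1 rfl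
  clear hS
  have hmem : (({Y} : Set V), ({X} : Set V), S) ∈ indepModel H := by
    refine ⟨by simpa using hlt.ne.symm, by simpa using hYS, by simpa using hXS,
      (separated_iff hH.isDAG).2 ?_⟩
    rintro A rfl B rfl - d hd
    -- A trail from `A` cannot escape. Going up, it enters the conditioning set without an arrowhead
    -- and is blocked; going down, it moves to the right and could only turn at a collider outside
    -- the conditioning set.
    have key : ∀ v d, Trail H S A v d →
        (v = A ∧ d = false) ∨ (LeftOf α A v ∧ d = true) ∨ (v ∈ S ∧ d = false) := by
      intro v d h
      induction h with
      | start => exact .inl ⟨rfl, rfl⟩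
      | @down v d w _ hv e ih =>
        refine .inr (.inl ⟨?_, rfl⟩)
        rcases ih with ⟨rfl, -⟩ | ⟨h, -⟩ | h
        · exact hH _ _ e
        · exact h.trans (hH _ _ e)
        · exact absurd h.1 hv
      | @up v d w _ hv e ih =>
        refine .inr (.inr ⟨?_, rfl⟩)
        rcases ih with ⟨rfl, -⟩ | ⟨h, rfl⟩ | ⟨h, rfl⟩
        · refine (hmS w).2 ⟨hH _ _ e, ?_⟩
          rintro rfl
          exact hn e
        · exact absurd ((hmS v).1 (hv.2 rfl)).1 h.asymm
        · exact absurd (hv.1 h) (by simp)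
    rcases key B d hd with ⟨h, -⟩ | ⟨h, -⟩ | ⟨h, -⟩
    · exact hlt.ne h
    · exact h.asymm hlt
    · exact hXS h
  refine (separated_iff hG₀).1 (hHG hmem).2.2.2 Y rfl X rfl hXS s ?_
  exact hc.symm.trail .start (by simpa using hYS)

/-! ### Construct β -/

theorem leftOf_iff_mem {l₁ l₂ : List V} {U W : V} (h : (l₁ ++ U :: l₂).Nodup) :
    LeftOf (l₁ ++ U :: l₂) W U ↔ W ∈ l₁ := by
  have hU : U ∉ l₁ := fun h' => (List.nodup_append.1 h).2.2 U h' U (by simp) rfl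
  unfold LeftOf
  rw [List.idxOf_append_of_notMem hU]
  by_cases hW : W ∈ l₁
  · have := List.idxOf_lt_length_iff.2 hW
    simp only [List.idxOf_append_of_mem hW, hW, iff_true]
    omega
  · simp only [List.idxOf_append_of_notMem hW, hW, iff_false]
    simp

/-- The state of Construct β: `β` is a list of the nodes outside `R`. -/
structure IsPartialOrder (G : Digraph V) (α : List V) (R : Finset V) (β : List V) : Prop where
  nodup : β.Nodup
  mem : ∀ v, v ∈ β ↔ v ∉ R
  child : ∀ l₁ U l₂, β = l₁ ++ U :: l₂ → ∀ W, G.Adj U W → W ∈ l₂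
  greedy : ∀ l₁ U l₂, β = l₁ ++ U :: l₂ → ∀ W, (W ∈ R ∨ W ∈ l₁) → LeftOf α U W →
    ∃ U', G.Adj W U' ∧ (U' = U ∨ U' ∈ l₁ ∨ U' ∈ R)

/-- The interchange loop never acts: if the head `B` is to the left of `A` in `α`, then greediness
provides a child of `A` that is `B` or in `R`, and a sink of `R` has no child in `R`. -/
theorem IsPartialOrder.place_eq {G : Digraph V} {R : Finset V} (h : IsPartialOrder G α R β)
    {A : V} (hA : IsSinkIn G R A) : place G α A β = A :: β := by
  cases β with
  | nil => rfl
  | cons B β =>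
    rw [place, if_neg]
    rintro ⟨hAB, hBA⟩
    obtain ⟨U, hAU, rfl | hU | hU⟩ := h.greedy [] B β rfl A (.inl hA.1) hBA
    · exact hAB hAU
    · simp at hU
    · exact hA.2 U hU hAU

theorem IsPartialOrder.cons {G : Digraph V} {R : Finset V}
    (h : IsPartialOrder G α R β) {A : V} (hA : IsRightmost α (IsSinkIn G R) A) :
    IsPartialOrder G α (R.erase A) (A :: β) where
  nodup := List.nodup_cons.2 ⟨fun h' => (h.mem A).1 h' hA.1.1, h.nodup⟩
  mem v := by
    rw [List.mem_cons, h.mem, Finset.mem_erase]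
    tauto
  child l₁ U l₂ hl W hUW := by
    cases l₁ with
    | nil =>
      obtain ⟨rfl, rfl⟩ : A = U ∧ β = l₂ := by simpa using hl
      exact (h.mem W).2 fun hW => hA.1.2 W hW hUW
    | cons C l₁ =>
      obtain ⟨rfl, rfl⟩ : A = C ∧ β = l₁ ++ U :: l₂ := by simpa using hl
      exact h.child l₁ U l₂ rfl W hUW
  greedy l₁ U l₂ hl W hW hUW := by
    cases l₁ with
    | nil =>
      obtain ⟨rfl, rfl⟩ : A = U ∧ β = l₂ := by simpa using hl
      have hW' : W ≠ A ∧ W ∈ R := by simpa using hW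
      -- `A` is the rightmost sink, so a remaining node `W` to its right in `α` is no sink and has a
      -- child in `R`.
      by_contra! hn
      refine hUW.asymm (hA.2 W ⟨hW'.2, fun B hB hWB => ?_⟩ hW'.1)
      have := hn B hWB
      exact this.2.2 (Finset.mem_erase.2 ⟨this.1, hB⟩)
    | cons C l₁ =>
      obtain ⟨rfl, rfl⟩ : A = C ∧ β = l₁ ++ U :: l₂ := by simpa using hl
      have hW' : W ∈ R ∨ W ∈ l₁ := by
        rcases hW with hW | hW
        · exact .inl (Finset.mem_of_mem_erase hW)
        · rcases List.mem_cons.1 hW with rfl | hW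
          exacts [.inl hA.1.1, .inr hW]
      obtain ⟨U', hWU', h'⟩ := h.greedy l₁ U l₂ rfl W hW' hUW
      refine ⟨U', hWU', ?_⟩
      rw [List.mem_cons, Finset.mem_erase]
      tauto

theorem IsPartialOrder.isStartOrder {G : Digraph V} (h : IsPartialOrder G α ∅ β) :
    IsStartOrder G α β where
  ordering := ⟨h.nodup, fun v => (h.mem v).2 (by simp)⟩
  consistent A B hAB := by
    have hβ : IsNodeOrdering β := ⟨h.nodup, fun v => (h.mem v).2 (by simp)⟩
    obtain ⟨l₁, l₂, rfl⟩ := List.append_of_mem (hβ.2 A)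
    have hB := h.child l₁ A l₂ rfl B hAB
    have hnd := List.nodup_append.1 h.nodup
    have hne : A ≠ B := by
      rintro rfl
      exact (List.nodup_cons.1 hnd.2.1).1 hB
    refine (hβ.total hne).resolve_right fun h' => ?_
    exact hnd.2.2 B ((leftOf_iff_mem h.nodup).1 h') B (by simp [hB]) rfl
  greedy W U hWU hUW := by
    obtain ⟨l₁, l₂, rfl⟩ := List.append_of_mem ((h.mem U).2 (by simp))
    obtain ⟨U', hWU', h'⟩ :=
      h.greedy l₁ U l₂ rfl W (.inr ((leftOf_iff_mem h.nodup).1 hWU)) hUW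
    exact ⟨U', hWU', h'.imp_right fun h' => (leftOf_iff_mem h.nodup).2 (by simpa using h')⟩

end Order

/-! ### Counting the arcs still to be added -/

/-- The arcs of `K` that are missing in `G`. -/
noncomputable def missingArcs (G K : Digraph V) : ℕ :=
  {p : V × V | K.Adj p.1 p.2 ∧ ¬ G.Adj p.1 p.2}.ncard

theorem addArc_le {G K : Digraph V} {A B : V} (hle : G ≤ K) (h : K.Adj A B) : addArc G A B ≤ K := by
  rintro X Y (hXY | ⟨rfl, rfl⟩)
  exacts [hle hXY, h]

theorem missingArcs_addArc_lt [Finite V] {G K : Digraph V} {A B : V} (hK : K.Adj A B)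
    (hG : ¬ G.Adj A B) : missingArcs (addArc G A B) K < missingArcs G K := by
  refine Set.ncard_lt_ncard ⟨fun p hp => ⟨hp.1, fun h => hp.2 (.inl h)⟩, fun h => ?_⟩
    (Set.toFinite _)
  exact (h (a := (A, B)) ⟨hK, hG⟩).2 (.inr ⟨rfl, rfl⟩)

theorem exists_missing_arc {G K : Digraph V} (hle : G ≤ K) (hne : G ≠ K) :
    ∃ A B, K.Adj A B ∧ ¬ G.Adj A B := by
  by_contra! h
  exact hne (le_antisymm hle fun A B hAB => h A B hAB)

/-! ### Existence of sinks, rightmost nodes and consistent orderings -/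

theorem IsDAG.exists_sink [Finite V] {G : Digraph V} (hG : IsDAG G) {R : Finset V}
    (hR : R.Nonempty) : ∃ A, IsSinkIn G R A := by
  let r : V → V → Prop := fun a b => Relation.TransGen G.Adj b a
  have : IsTrans V r := ⟨fun _ _ _ h h' => h'.trans h⟩
  have : Std.Irrefl r := ⟨hG⟩
  obtain ⟨A, hA, hmin⟩ := (Finite.wellFounded_of_trans_of_irrefl r).has_min (R : Set V) hR
  exact ⟨A, hA, fun B hB hAB => hmin B hB (.single hAB)⟩

theorem IsDAG.exists_consistent [Fintype V] [DecidableEq V] {G : Digraph V} (hG : IsDAG G) :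
    ∃ α, IsNodeOrdering α ∧ Consistent G α := by
  have H : ∀ n, ∀ R : Finset V, R.card = n → ∃ l : List V, l.Nodup ∧ (∀ v, v ∈ l ↔ v ∈ R) ∧
      ∀ A ∈ R, ∀ B ∈ R, G.Adj A B → LeftOf l A B := by
    intro n
    induction n with
    | zero =>
      intro R hR
      obtain rfl := Finset.card_eq_zero.1 hR
      exact ⟨[], by simp⟩
    | succ n ih =>
      intro R hR
      -- A sink can be put last, behind an ordering of the other nodes.
      obtain ⟨A, hA, hs⟩ := hG.exists_sink (R := R) (Finset.card_pos.1 (by omega))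
      obtain ⟨l, hnd, hmem, hl⟩ := ih (R.erase A) (by rw [Finset.card_erase_of_mem hA]; omega)
      have hAl : A ∉ l := by simp [hmem]
      refine ⟨l ++ [A], ?_, fun v => ?_, fun B hB C hC hBC => ?_⟩
      · rw [List.nodup_append]
        refine ⟨hnd, by simp, fun a ha b hb => ?_⟩
        rintro rfl
        exact hAl (by simpa using List.mem_singleton.1 hb ▸ ha)
      · rw [List.mem_append, hmem, Finset.mem_erase, List.mem_singleton]
        by_cases hv : v = A
        · simp [hv, hA]
        · simp [hv]
      · have hBA : B ≠ A := by
          rintro rfl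
          exact hs C hC hBC
        have hBl : B ∈ l := by simp [hmem, hBA, hB]
        unfold LeftOf
        rw [List.idxOf_append_of_mem hBl]
        by_cases hCA : C = A
        · subst hCA
          rw [List.idxOf_append_of_notMem hAl]
          have := List.idxOf_lt_length_iff.2 hBl
          omega
        · have hCl : C ∈ l := by simp [hmem, hCA, hC]
          rw [List.idxOf_append_of_mem hCl]
          exact hl B (by simp [hBA, hB]) C (by simp [hCA, hC]) hBC
  obtain ⟨l, hnd, hmem, hl⟩ := H _ Finset.univ rfl
  exact ⟨l, ⟨hnd, fun v => (hmem v).2 (Finset.mem_univ v)⟩,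
    fun A B hAB => hl A (Finset.mem_univ A) B (Finset.mem_univ B) hAB⟩

theorem IsNodeOrdering.exists_isRightmost [Fintype V] [DecidableEq V] {α : List V}
    (hα : IsNodeOrdering α) {P : V → Prop} (hP : ∃ v, P v) : ∃ A, IsRightmost α P A := by
  classical
  obtain ⟨v, hv⟩ := hP
  obtain ⟨A, hA, hmax⟩ := Finset.exists_max_image (Finset.univ.filter P) (α.idxOf ·)
    ⟨v, by simpa using hv⟩
  refine ⟨A, by simpa using hA, fun B hB hBA => ?_⟩
  exact (hα.total hBA).resolve_right fun h => absurd (hmax B (by simpa using hB)) (not_le.2 h)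

/-- `G'` results from `G` by at most one arc addition or covered arc reversal. -/
def IsModification (G G' : Digraph V) : Prop :=
  G' = G ∨ IsArcAddition G G' ∨ IsCoveredArcReversal G G'

theorem IsModification.indepModel_subset {G G' : Digraph V} (h : IsModification G G')
    (hG : IsDAG G) (hG' : IsDAG G') : indepModel G' ⊆ indepModel G := by
  rcases h with rfl | ⟨A, B, -, rfl⟩ | ⟨A, B, hAB, rfl⟩
  · exact subset_rfl
  · exact indepModel_anti hG hG' fun _ _ => Or.inl
  · exact indepModel_reverseArc hG hAB hG'

section Run

variable [DecidableEq V]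

/-! ### The invariant of Method B2 -/

/-- The invariant of Method B2 with the node ordering `α` on the input `G₀`. -/
def B2State.Inv (α : List V) (G₀ : Digraph V) : B2State V → Prop
  | construct G R β => G = G₀ ∧ IsPartialOrder G₀ α R β
  | select G β D =>
    (∃ β₀, IsStartOrder G₀ α β₀ ∧ IsSelectOrder α β₀ β D) ∧ IsNecessary G₀ β G
  | percolate G β D Y =>
    (∃ β₀, IsStartOrder G₀ α β₀ ∧ IsPercolateOrder α β₀ β D Y) ∧ IsNecessary G₀ β G
  -- Necessity is recorded for the outcome of the reversal and the interchange; of the partly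
  -- covered graph it is only kept that it lies below `K`.
  | cover G K β D Y Z =>
    (∃ β₀, IsStartOrder G₀ α β₀ ∧ IsPercolateOrder α β₀ β D Y) ∧ LeftOf α Z Y ∧
      (∃ l₁ l₂, β = l₁ ++ Y :: Z :: l₂) ∧ G ≤ K ∧ IsCovered K Y Z ∧ Consistent K β ∧
      ∀ l₁ l₂, β = l₁ ++ Y :: Z :: l₂ → IsNecessary G₀ (l₁ ++ Z :: Y :: l₂) (reverseArc K Y Z)
  | interchange G β D Y Z =>
    (∃ β₀, IsStartOrder G₀ α β₀ ∧ IsPercolateOrder α β₀ β D Y) ∧ LeftOf α Z Y ∧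
      (∃ l₁ l₂, β = l₁ ++ Y :: Z :: l₂) ∧
      ∀ l₁ l₂, β = l₁ ++ Y :: Z :: l₂ → IsNecessary G₀ (l₁ ++ Z :: Y :: l₂) G
  | ret G => IsNecessary G₀ α G

theorem B2State.inv_init [Fintype V] (α : List V) (G₀ : Digraph V) : (B2State.init G₀).Inv α G₀ :=
  ⟨rfl, { nodup := List.nodup_nil
          mem := by simp
          child := by simp
          greedy := by simp }⟩

theorem B2State.Inv.isDAG {α : List V} {G₀ : Digraph V} (hG₀ : IsDAG G₀) {s : B2State V}
    (h : s.Inv α G₀) : IsDAG s.graph := by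
  cases s with
  | construct G R β => exact h.1 ▸ hG₀
  | select G β D => exact h.2.consistent.isDAG
  | percolate G β D Y => exact h.2.consistent.isDAG
  | cover G K β D Y Z => exact (h.2.2.2.2.2.1.mono h.2.2.2.1).isDAG
  | interchange G β D Y Z =>
    obtain ⟨-, -, ⟨l₁, l₂, hβ⟩, h⟩ := h
    exact (h l₁ l₂ hβ).consistent.isDAG
  | ret G => exact IsNecessary.consistent h |>.isDAG

theorem B2Step.inv {α : List V} (hα : IsNodeOrdering α) {G₀ : Digraph V}
    {s t : B2State V} (hst : B2Step α s t) (h : s.Inv α G₀) : t.Inv α G₀ := by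
  cases hst with
  | construct_next G R β A hA =>
    obtain ⟨rfl, h⟩ := h
    exact ⟨rfl, by rw [h.place_eq hA.1]; exact h.cons hA⟩
  | construct_end G β =>
    obtain ⟨rfl, h⟩ := h
    refine ⟨⟨β, h.isStartOrder, ?_⟩, h.isStartOrder.consistent.isNecessary⟩
    exact ⟨h.isStartOrder.ordering, by simp, fun _ _ _ _ h => h, by simp, by simp⟩
  | select_next G β D Y hβ hY =>
    obtain ⟨⟨β₀, h₀, h⟩, hG⟩ := h
    exact ⟨⟨β₀, h₀, h.percolate hα hY⟩, hG⟩
  | select_end G D => exact h.2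
  | percolate_arc G K l₁ l₂ D Y Z hZ hYZ hK =>
    obtain ⟨⟨β₀, h₀, h⟩, hG⟩ := h
    have hK' := hK.eq hG.consistent.isDAG hYZ
    refine ⟨⟨β₀, h₀, h⟩, hZ, ⟨l₁, l₂, rfl⟩, hK.1.1, hK.1.2, ?_, fun k₁ k₂ hk => ?_⟩
    · exact hK' ▸ hG.consistent_coveringGraph h.ordering
    · rw [hk] at h hG
      exact hK' ▸ hG.reverse_coveringGraph hα h₀ h hZ hYZ
  | percolate_noarc G l₁ l₂ D Y Z hZ hYZ =>
    obtain ⟨⟨β₀, h₀, h⟩, hG⟩ := h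
    refine ⟨⟨β₀, h₀, h⟩, hZ, ⟨l₁, l₂, rfl⟩, fun k₁ k₂ hk => ?_⟩
    rw [hk] at h hG
    exact hG.swap hα h₀ h hZ hYZ
  | percolate_end G β D Y hend =>
    obtain ⟨⟨β₀, h₀, h⟩, hG⟩ := h
    exact ⟨⟨β₀, h₀, h.select hα hend⟩, hG⟩
  | cover_add G K β D Y Z A B hK hG =>
    obtain ⟨h₁, h₂, h₃, h₄, h₅⟩ := h
    exact ⟨h₁, h₂, h₃, addArc_le h₄ hK, h₅⟩
  | cover_reverse K β D Y Z =>
    obtain ⟨h₁, h₂, h₃, -, -, -, h₅⟩ := h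
    exact ⟨h₁, h₂, h₃, h₅⟩
  | swap G l₁ l₂ D Y Z =>
    obtain ⟨⟨β₀, h₀, h⟩, hZ, -, hG⟩ := h
    exact ⟨⟨β₀, h₀, h.swap hZ⟩, hG l₁ l₂ rfl⟩

theorem B2State.Inv.progress [Fintype V] {α : List V} (hα : IsNodeOrdering α) {G₀ : Digraph V}
    (hG₀ : IsDAG G₀) {s : B2State V} (h : s.Inv α G₀) :
    (∃ t, B2Step α s t) ∨ ∃ G, s = .ret G := by
  cases s with
  | construct G R β =>
    left
    rcases R.eq_empty_or_nonempty with rfl | hR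
    · exact ⟨_, .construct_end G β⟩
    · obtain ⟨A, hA⟩ := hα.exists_isRightmost ((h.1 ▸ hG₀ : IsDAG G).exists_sink hR)
      exact ⟨_, .construct_next G R β A hA⟩
  | select G β D =>
    left
    obtain ⟨⟨β₀, h₀, h⟩, -⟩ := h
    by_cases hβ : β = α
    · subst hβ
      exact ⟨_, .select_end G D⟩
    -- When all nodes have been considered, the whole of `β` is ordered as `α`.
    · have hD : ∃ v, v ∉ D := by
        by_contra! hD
        exact hβ (eq_of_leftOf_imp hα h.ordering fun A B => h.right A B (hD A) (hD B))
      obtain ⟨Y, hY⟩ := hα.exists_isRightmost hD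
      exact ⟨_, .select_next G β D Y hβ hY⟩
  | percolate G β D Y =>
    left
    by_cases hend : ∀ l₁ Z l₂, β = l₁ ++ Y :: Z :: l₂ → ¬ LeftOf α Z Y
    · exact ⟨_, .percolate_end G β D Y hend⟩
    · push Not at hend
      obtain ⟨l₁, Z, l₂, rfl, hZ⟩ := hend
      by_cases hYZ : G.Adj Y Z
      · exact ⟨_, .percolate_arc G _ l₁ l₂ D Y Z hZ hYZ
          (isCovering_coveringGraph h.2.consistent.isDAG hYZ)⟩
      · exact ⟨_, .percolate_noarc G l₁ l₂ D Y Z hZ hYZ⟩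
  | cover G K β D Y Z =>
    left
    by_cases hGK : G = K
    · subst hGK
      exact ⟨_, .cover_reverse G β D Y Z⟩
    · obtain ⟨A, B, hK, hG⟩ := exists_missing_arc h.2.2.2.1 hGK
      exact ⟨_, .cover_add G K β D Y Z A B hK hG⟩
  | interchange G β D Y Z =>
    obtain ⟨-, -, ⟨l₁, l₂, rfl⟩, -⟩ := h
    exact .inl ⟨_, .swap G l₁ l₂ D Y Z⟩
  | ret G => exact .inr ⟨G, rfl⟩

theorem B2Step.isModification {α : List V} {G₀ : Digraph V} {s t : B2State V}
    (hst : B2Step α s t) (h : s.Inv α G₀) : IsModification s.graph t.graph := by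
  cases hst with
  | cover_add G K β D Y Z A B hK hG => exact .inr (.inl ⟨A, B, hG, rfl⟩)
  | cover_reverse K β D Y Z => exact .inr (.inr ⟨Y, Z, h.2.2.2.2.1, rfl⟩)
  | _ => exact .inl rfl

/-! ### Termination -/

/-- Decreases in every step of Method B2. -/
noncomputable def B2State.rank [Fintype V] : B2State V → ℕ ×ₗ ℕ ×ₗ ℕ ×ₗ ℕ
  | construct _ R _ => toLex (4, toLex (R.card, toLex (0, 0)))
  -- Selecting a node lowers `2 * Dᶜ.card` by 2, which leaves room for the `+ 1` of the percolation.
  -- An interchange lowers the distance of `Y` from the end by 1, thus its triple by 3, enough for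
  -- the offsets 2, 1, 0 of percolating, covering and interchanging.
  | select _ _ D => toLex (3, toLex (2 * Dᶜ.card, toLex (0, 0)))
  | percolate _ β D Y =>
    toLex (3, toLex (2 * Dᶜ.card + 1, toLex (3 * (β.length - β.idxOf Y) + 2, 0)))
  | cover G K β D Y _ =>
    toLex (3, toLex (2 * Dᶜ.card + 1,
      toLex (3 * (β.length - β.idxOf Y) + 1, missingArcs G K)))
  | interchange _ β D Y _ =>
    toLex (3, toLex (2 * Dᶜ.card + 1, toLex (3 * (β.length - β.idxOf Y), 0)))
  | ret _ => toLex (2, toLex (0, toLex (0, 0)))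

/-- The invariant matters only for an interchange: since `β` has no repetitions, the position of `Y`
really grows by one. -/
theorem B2Step.rank_lt [Fintype V] {α : List V} {G₀ : Digraph V} {s t : B2State V}
    (hst : B2Step α s t) (h : s.Inv α G₀) : t.rank < s.rank := by
  cases hst with
  | construct_next G R β A hA =>
    have := Finset.card_erase_lt_of_mem hA.1.1
    simp [B2State.rank, Prod.Lex.toLex_lt_toLex, this]
  | select_next G β D Y hβ hY =>
    have : ((insert Y D)ᶜ).card < Dᶜ.card := by
      refine Finset.card_lt_card ((Finset.ssubset_iff_of_subset ?_).2 ⟨Y, ?_, ?_⟩)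
      · intro v
        simp
      · simpa using hY.1
      · simp
    exact Prod.Lex.toLex_lt_toLex.2 (.inr ⟨rfl, Prod.Lex.toLex_lt_toLex.2 (.inl (by simp only; omega))⟩)
  | cover_add G K β D Y Z A B hK hG =>
    simp [B2State.rank, Prod.Lex.toLex_lt_toLex, missingArcs_addArc_lt hK hG]
  | swap G l₁ l₂ D Y Z =>
    obtain ⟨⟨β₀, h₀, h⟩, -⟩ := h
    have h₁ := (idxOf_middle h.ordering.1).1
    have h₂ := (idxOf_middle h.ordering.swap.1).2
    have h₃ := l₁.length_append (bs := Y :: Z :: l₂)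
    have h₄ := l₁.length_append (bs := Z :: Y :: l₂)
    rw [List.length_cons, List.length_cons] at h₃ h₄
    exact Prod.Lex.toLex_lt_toLex.2 (.inr ⟨rfl, Prod.Lex.toLex_lt_toLex.2
      (.inr ⟨rfl, Prod.Lex.toLex_lt_toLex.2 (.inl (by simp only; omega))⟩)⟩)
  | _ => simp [B2State.rank, Prod.Lex.toLex_lt_toLex]

/-! ### Method G2H -/

variable [Fintype V]

/-- The invariant of Method G2H on the input `G₀`, `H`. -/
def G2HState.Inv (G₀ H : Digraph V) : G2HState V → Prop
  | start G => G = G₀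
  | runB2 α s => IsNodeOrdering α ∧ Consistent H α ∧ s.Inv α G₀
  | addMissing G => G ≤ H
  | halt G => G = H

/-- Decreases in every step of Method G2H with target `H`. -/
noncomputable def G2HState.rank (H : Digraph V) : G2HState V → ℕ ×ₗ ℕ ×ₗ ℕ ×ₗ ℕ
  | start _ => toLex (5, toLex (0, toLex (0, 0)))
  | runB2 _ s => s.rank
  | addMissing G => toLex (1, toLex (missingArcs G H, toLex (0, 0)))
  | halt _ => toLex (0, toLex (0, toLex (0, 0)))

variable {G₀ H : Digraph V}

theorem G2HStep.inv (hG₀ : IsDAG G₀) (hHG : indepModel H ⊆ indepModel G₀) {s t : G2HState V}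
    (hst : G2HStep H s t) (h : s.Inv G₀ H) : t.Inv G₀ H := by
  cases hst with
  | choose G α hα hH =>
    obtain rfl : G = G₀ := h
    exact ⟨hα, hH, B2State.inv_init α G⟩
  | b2 α s s' hs => exact ⟨h.1, h.2.1, hs.inv h.1 h.2.2⟩
  | b2_ret α G => exact IsNecessary.le hG₀ h.2.2 h.2.1 hHG
  | add G A B hH hG => exact addArc_le h hH
  | finish G hle => exact le_antisymm h hle

theorem G2HStep.rank_lt {s t : G2HState V} (hst : G2HStep H s t) (h : s.Inv G₀ H) :
    t.rank H < s.rank H := by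
  cases hst with
  | b2 α s s' hs => exact hs.rank_lt h.2.2
  | add G A B hH hG =>
    simp [G2HState.rank, Prod.Lex.toLex_lt_toLex, missingArcs_addArc_lt hH hG]
  | _ => simp [G2HState.rank, B2State.rank, B2State.init, Prod.Lex.toLex_lt_toLex]

theorem G2HState.Inv.isDAG (hG₀ : IsDAG G₀) (hH : IsDAG H) {s : G2HState V} (h : s.Inv G₀ H) :
    IsDAG s.graph := by
  cases s with
  | start G => exact (show G = G₀ from h) ▸ hG₀
  | runB2 α s => exact h.2.2.isDAG hG₀
  | addMissing G =>
    obtain ⟨α, -, hα⟩ := hH.exists_consistent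
    exact (hα.mono h).isDAG
  | halt G => exact (show G = H from h) ▸ hH

theorem G2HState.Inv.progress (hG₀ : IsDAG G₀) (hH : IsDAG H) {s : G2HState V} (h : s.Inv G₀ H) :
    (∃ t, G2HStep H s t) ∨ s = .halt H := by
  cases s with
  | start G =>
    obtain ⟨α, hα, hα'⟩ := hH.exists_consistent
    exact .inl ⟨_, .choose G α hα hα'⟩
  | runB2 α s =>
    rcases h.2.2.progress h.1 hG₀ with ⟨t, ht⟩ | ⟨G, rfl⟩
    · exact .inl ⟨_, .b2 α s t ht⟩
    · exact .inl ⟨_, .b2_ret α G⟩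
  | addMissing G =>
    by_cases hHG : G = H
    · exact .inl ⟨_, .finish G hHG.ge⟩
    · obtain ⟨A, B, hAB, hAB'⟩ := exists_missing_arc h hHG
      exact .inl ⟨_, .add G A B hAB hAB'⟩
  | halt G => exact .inr (congrArg _ h)

theorem G2HStep.isModification {s t : G2HState V} (hst : G2HStep H s t) (h : s.Inv G₀ H) :
    IsModification s.graph t.graph := by
  cases hst with
  | b2 α s s' hs => exact hs.isModification h.2.2
  | add G A B hH hG => exact .inr (.inl ⟨A, B, hG, rfl⟩)
  | _ => exact .inl rfl

/-! ### Whole runs of Method G2H -/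

theorem G2HReachable.inv (hG₀ : IsDAG G₀) (hHG : indepModel H ⊆ indepModel G₀) {s : G2HState V}
    (h : G2HReachable G₀ H s) : s.Inv G₀ H := by
  induction h with
  | refl => rfl
  | tail _ hst ih => exact hst.inv hG₀ hHG ih

/-- One of the operations in Meek's conjecture with target `H`. -/
def MeekStep (H G₁ G₂ : Digraph V) : Prop :=
  (IsArcAddition G₁ G₂ ∨ IsCoveredArcReversal G₁ G₂) ∧
    IsDAG G₂ ∧ indepModel H ⊆ indepModel G₂

/-- Well-founded induction on the rank works backwards from the final state, whose graph is `H`.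
Each step shrinks or keeps the independence model, so the inclusion for the next graph passes to the
current one. -/
theorem G2HState.Inv.run (hG₀ : IsDAG G₀) (hH : IsDAG H) (hHG : indepModel H ⊆ indepModel G₀)
    {s : G2HState V} (h : s.Inv G₀ H) :
    indepModel H ⊆ indepModel s.graph ∧ Relation.ReflTransGen (MeekStep H) s.graph H := by
  induction hr : s.rank H using WellFoundedLT.induction generalizing s with
  | _ r ih =>
    subst hr
    rcases h.progress hG₀ hH with ⟨t, hst⟩ | rfl
    · have ht := hst.inv hG₀ hHG h
      obtain ⟨ih₁, ih₂⟩ := ih _ (hst.rank_lt h) ht rfl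
      have hm := hst.isModification h
      refine ⟨ih₁.trans (hm.indepModel_subset (h.isDAG hG₀ hH) (ht.isDAG hG₀ hH)), ?_⟩
      rcases hm with hm | hm
      · exact hm ▸ ih₂
      · exact .head ⟨hm, ht.isDAG hG₀ hH, ih₁⟩ ih₂
    · exact ⟨subset_rfl, .refl⟩

theorem G2HStep.not_exists_infinite_run (hG₀ : IsDAG G₀) (hHG : indepModel H ⊆ indepModel G₀) :
    ¬ ∃ run : ℕ → G2HState V, run 0 = .start G₀ ∧ ∀ n, G2HStep H (run n) (run (n + 1)) := by
  rintro ⟨run, h0, hrun⟩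
  have hinv : ∀ n, (run n).Inv G₀ H := by
    intro n
    induction n with
    | zero => rw [h0]; rfl
    | succ n ih => exact (hrun n).inv hG₀ hHG ih
  have hwf : WellFounded ((· < ·) : ℕ ×ₗ ℕ ×ₗ ℕ ×ₗ ℕ → _ → Prop) := wellFounded_lt
  exact (RelEmbedding.natGT (r := (· < ·)) (fun n => (run n).rank H)
    fun n => (hrun n).rank_lt (hinv n)).not_wellFounded hwf

end Run

end BayesNet

/-- Let `G` and `H` be DAGs on the same finite node set with `I(H) ⊆ I(G)`.
(1) Every run of Method G2H on `G`, `H` is finite.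
(2) In every state of every run the current graph is a DAG and `I(H) ⊆ I(G)` holds for it; the method
never gets stuck before it halts, and when it stops it has halted with the graph `H`; and every step
leaves the graph unchanged, adds one arc, or reverses one covered arc.
(3) Meek's conjecture: `G` can be transformed into `H` by arc additions and covered arc reversals such
that after each operation the graph is a DAG whose independence model contains `I(H)`. -/
theorem mainTheorem5 {V : Type*} [Fintype V] [DecidableEq V] (G H : Digraph V)
    (hG : BayesNet.IsDAG G) (hH : BayesNet.IsDAG H)
    (hHG : BayesNet.indepModel H ⊆ BayesNet.indepModel G) :
    (¬ ∃ run : ℕ → BayesNet.G2HState V,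
      run 0 = BayesNet.G2HState.start G ∧ ∀ n, BayesNet.G2HStep H (run n) (run (n + 1))) ∧
    (∀ s : BayesNet.G2HState V, BayesNet.G2HReachable G H s →
      (BayesNet.IsDAG s.graph ∧ BayesNet.indepModel H ⊆ BayesNet.indepModel s.graph) ∧
      ((∃ t, BayesNet.G2HStep H s t) ∨ s = BayesNet.G2HState.halt H) ∧
      ∀ t, BayesNet.G2HStep H s t →
        t.graph = s.graph ∨ BayesNet.IsArcAddition s.graph t.graph ∨
          BayesNet.IsCoveredArcReversal s.graph t.graph) ∧
    Relation.ReflTransGen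
      (fun G₁ G₂ : Digraph V =>
        (BayesNet.IsArcAddition G₁ G₂ ∨ BayesNet.IsCoveredArcReversal G₁ G₂) ∧
          BayesNet.IsDAG G₂ ∧ BayesNet.indepModel H ⊆ BayesNet.indepModel G₂)
      G H := by
  refine ⟨BayesNet.G2HStep.not_exists_infinite_run hG hHG, fun s hs => ?_,
    (BayesNet.G2HState.Inv.run (s := .start G) hG hH hHG rfl).2⟩
  have h := hs.inv hG hHG
  exact ⟨⟨h.isDAG hG hH, (h.run hG hH hHG).1⟩, h.progress hG hH, fun t ht => ht.isModification h⟩
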